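/- Let $M$ be a simply connected oriented smooth manifold (possibly with boundary), let $K\subset M$ be an oriented, properly embedded smooth submanifold of codimension $2$ (with $\partial K=K\cap\partial M$, the intersection being transverse), and let $p\in M\setminus K$. Let $N\subset\mathbb C$ be the noose, i.e. the union of the closed unit disk and the real segment $[1,2]$. A noose in $(M,K,p)$ is a continuous map $\nu:N\to M$ with $\nu(2)=p$ and $\nu^{-1}(K)=\{0\}$. Let $Q(M,K,p)$ (the underlying set of the knot quandle) be the set of homotopy classes, where homotopies are through nooses in $(M,K,p)$, of those nooses $\nu$ whose bounding circle $\nu|_{S^1}$ has signed linking number $1$ with $K$, i.e. for which the local intersection number at $0$ of the disk of $\nu$ with $K$ is $+1$. Let the augmentation $\ell:Q(M,K,p)\to\pi_1(M\setminus K,p)$ send the class of $\nu$ to the homotopy class of its canonical loop, which traverses the arc $\nu([1,2])$ from $p$, then $\nu(S^1)$ counterclockwise, then the arc back to $p$. Then the image $\ell(Q(M,K,p))$ generates the group $\pi_1(M\setminus K,p)$. -/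

import Mathlib

open scoped Manifold ContDiff Topology unitInterval

noncomputable section

namespace KnotQuandle

/-! ### Nooses in a pointed pair -/

/-- The noose `N ⊆ ℂ`: the union of the closed unit disk and the real segment `[1, 2]`. -/
def nooseSet : Set ℂ := Metric.closedBall 0 1 ∪ segment ℝ 1 2

/-- The noose as a topological space. -/
abbrev NooseSpace : Type := nooseSet

/-- The distinguished point `0` of the noose (its distinguished subspace is `{0}`). -/
def NooseSpace.center : NooseSpace := ⟨0, Or.inl (by simp)⟩

/-- The base point `2` of the noose. -/
def NooseSpace.base : NooseSpace := ⟨2, Or.inr (right_mem_segment ℝ 1 2)⟩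

/-- The point `r * exp (2 π i t)` of the disk of the noose. -/
def NooseSpace.diskPoint (r t : I) : NooseSpace :=
  ⟨(r : ℝ) * Complex.exp (2 * Real.pi * Complex.I * (t : ℝ)), Or.inl (by
    have h : ‖Complex.exp (2 * Real.pi * Complex.I * (t : ℝ))‖ = 1 := by
      have := Complex.norm_exp_ofReal_mul_I (2 * Real.pi * t)
      rw [← this]
      congr 2
      push_cast
      ring
    have h0 : |(r : ℝ)| = r := abs_of_nonneg r.2.1
    simpa [h, h0] using r.2.2)⟩

/-- The point `2 - t` of the segment `[1, 2]` of the noose. -/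
def NooseSpace.arcPoint (t : I) : NooseSpace :=
  ⟨((2 - t : ℝ) : ℂ), Or.inr ⟨t, 1 - t, t.2.1, by linarith [t.2.2], by ring, by
    simp only [Complex.real_smul]
    push_cast
    ring⟩⟩

lemma NooseSpace.continuous_diskPoint (r : I) :
    Continuous (NooseSpace.diskPoint r) := by
  unfold NooseSpace.diskPoint
  fun_prop

lemma NooseSpace.continuous_arcPoint : Continuous NooseSpace.arcPoint := by
  unfold NooseSpace.arcPoint
  fun_prop

lemma NooseSpace.arcPoint_zero : NooseSpace.arcPoint 0 = NooseSpace.base := by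
  ext
  simp [NooseSpace.arcPoint, NooseSpace.base]

lemma NooseSpace.diskPoint_one_zero :
    NooseSpace.diskPoint 1 0 = NooseSpace.arcPoint 1 := by
  ext
  simp [NooseSpace.arcPoint, NooseSpace.diskPoint]
  norm_num

lemma NooseSpace.diskPoint_one_one :
    NooseSpace.diskPoint 1 1 = NooseSpace.arcPoint 1 := by
  ext
  simp [NooseSpace.arcPoint, NooseSpace.diskPoint, Complex.exp_two_pi_mul_I]
  norm_num

lemma NooseSpace.arcPoint_ne_center (t : I) : NooseSpace.arcPoint t ≠ NooseSpace.center := by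
  intro h
  have h' : ((2 - t : ℝ) : ℂ) = 0 := congrArg Subtype.val h
  have h'' : (2 - t : ℝ) = 0 := by exact_mod_cast h'
  linarith [t.2.2]

lemma NooseSpace.diskPoint_one_ne_center (t : I) :
    NooseSpace.diskPoint 1 t ≠ NooseSpace.center := by
  intro h
  have h' := congrArg Subtype.val h
  simp [NooseSpace.diskPoint, NooseSpace.center] at h'

section Pair

variable {X : Type*} [TopologicalSpace X]

/-- `ν` is a map of pointed pairs from `(N, {0}, 2)` to `(X, S, p)`: it preserves the base point,
the subspace and the complement of the subspace. -/
def IsNoose (S : Set X) (p : X) (ν : C(NooseSpace, X)) : Prop :=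
  ν NooseSpace.base = p ∧ ∀ z, ν z ∈ S ↔ z = NooseSpace.center

/-- The maps of pointed pairs from the noose `(N, {0}, 2)` to `(X, S, p)`. -/
def Noose (S : Set X) (p : X) : Type _ := {ν : C(NooseSpace, X) // IsNoose S p ν}

/-- Homotopy of nooses, through maps of pointed pairs. -/
def nooseSetoid (S : Set X) (p : X) : Setoid (Noose S p) where
  r ν μ := ContinuousMap.HomotopicWith ν.1 μ.1 (IsNoose S p)
  iseqv :=
    { refl := fun ν => ContinuousMap.HomotopicWith.refl ν.1 ν.2
      symm := fun h => ContinuousMap.HomotopicWith.symm h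
      trans := fun h₁ h₂ => ContinuousMap.HomotopicWith.trans h₁ h₂ }

/-- The underlying set of the fundamental quandle `Π(X, S, p)`: homotopy classes of nooses. -/
def FundamentalQuandle (S : Set X) (p : X) : Type _ := Quotient (nooseSetoid S p)

/-- The class of a noose in the fundamental quandle. -/
def FundamentalQuandle.mk {S : Set X} {p : X} (ν : Noose S p) : FundamentalQuandle S p :=
  Quotient.mk (nooseSetoid S p) ν

variable {S : Set X} {p : X}

/-- The value of a noose away from its center, as a point of the complement. -/
def Noose.eval (ν : Noose S p) (z : NooseSpace) (hz : z ≠ NooseSpace.center) : (Sᶜ : Set X) :=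
  ⟨ν.1 z, fun h => hz ((ν.2.2 z).1 h)⟩

/-- The arc of a noose, traversed from the base point `p`, as a path in the complement. -/
def Noose.arc (hp : p ∉ S) (ν : Noose S p) :
    Path (⟨p, hp⟩ : (Sᶜ : Set X))
      (ν.eval (NooseSpace.arcPoint 1) (NooseSpace.arcPoint_ne_center 1)) where
  toFun t := ν.eval (NooseSpace.arcPoint t) (NooseSpace.arcPoint_ne_center t)
  continuous_toFun := (ν.1.continuous.comp NooseSpace.continuous_arcPoint).subtype_mk _
  source' := by
    ext
    simp only [Noose.eval, NooseSpace.arcPoint_zero]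
    exact ν.2.1
  target' := rfl

/-- The bounding circle of a noose, traversed counterclockwise from the point `1`, as a loop in
the complement. -/
def Noose.circle (ν : Noose S p) :
    Path (ν.eval (NooseSpace.arcPoint 1) (NooseSpace.arcPoint_ne_center 1))
      (ν.eval (NooseSpace.arcPoint 1) (NooseSpace.arcPoint_ne_center 1)) where
  toFun t := ν.eval (NooseSpace.diskPoint 1 t) (NooseSpace.diskPoint_one_ne_center t)
  continuous_toFun := (ν.1.continuous.comp (NooseSpace.continuous_diskPoint 1)).subtype_mk _
  source' := by simp only [NooseSpace.diskPoint_one_zero]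
  target' := by simp only [NooseSpace.diskPoint_one_one]

/-- The canonical loop of a noose: it traverses the arc, then the boundary of the disk
counterclockwise, then the arc back to `p`. -/
def Noose.canonicalLoop (hp : p ∉ S) (ν : Noose S p) :
    Path (⟨p, hp⟩ : (Sᶜ : Set X)) ⟨p, hp⟩ :=
  ((ν.arc hp).trans ν.circle).trans (ν.arc hp).symm

lemma Noose.canonicalLoop_homotopic (hp : p ∉ S) {ν μ : Noose S p}
    (h : ContinuousMap.HomotopicWith ν.1 μ.1 (IsNoose S p)) :
    (ν.canonicalLoop hp).Homotopic (μ.canonicalLoop hp) := by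
  obtain ⟨F⟩ := h
  let N : I → Noose S p := fun s => ⟨_, F.prop' s⟩
  have hN : ∀ s z, (N s).1 z = F (s, z) := fun _ _ => rfl
  have hN0 : N 0 = ν := Subtype.ext (ContinuousMap.ext fun z => F.apply_zero z)
  have hN1 : N 1 = μ := Subtype.ext (ContinuousMap.ext fun z => F.apply_one z)
  have harc : Continuous ↿fun s => (N s).arc hp := by
    refine Continuous.subtype_mk (f := fun q : I × I => F (q.1, NooseSpace.arcPoint q.2)) ?_ _
    exact F.continuous.comp
      (continuous_fst.prodMk (NooseSpace.continuous_arcPoint.comp continuous_snd))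
  have hcirc : Continuous ↿fun s => (N s).circle := by
    refine Continuous.subtype_mk (f := fun q : I × I => F (q.1, NooseSpace.diskPoint 1 q.2)) ?_ _
    exact F.continuous.comp
      (continuous_fst.prodMk ((NooseSpace.continuous_diskPoint 1).comp continuous_snd))
  have hloop : Continuous ↿fun s => (N s).canonicalLoop hp :=
    Path.trans_continuous_family _ (Path.trans_continuous_family _ harc _ hcirc) _
      (Path.symm_continuous_family _ harc)
  refine ⟨{ toFun := fun q => (N q.1).canonicalLoop hp q.2
            continuous_toFun := hloop
            map_zero_left := fun t => by rw [hN0]; rfl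
            map_one_left := fun t => by rw [hN1]; rfl
            prop' := ?_ }⟩
  intro s t ht
  rcases ht with rfl | rfl
  · simp
  · simp

/-- The augmentation `ℓ`: the class of a noose is sent to the homotopy class of its canonical
loop in the complement. -/
def augmentation (S : Set X) (p : X) (hp : p ∉ S) (q : FundamentalQuandle S p) :
    FundamentalGroup (Sᶜ : Set X) ⟨p, hp⟩ :=
  Quotient.lift (s := nooseSetoid S p)
    (fun ν => FundamentalGroup.fromPath (Path.Homotopic.Quotient.mk (ν.canonicalLoop hp)))
    (fun _ _ h => Path.Homotopic.Quotient.eq.2 (Noose.canonicalLoop_homotopic hp h)) q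

end Pair

/-! ### Oriented manifolds and linking numbers -/

/-- The model `J` describes manifolds with (possibly empty) boundary: its range is the whole model
vector space (the case `a = 0`) or a closed half-space. -/
def IsBoundaryModel {E H : Type*} [NormedAddCommGroup E] [NormedSpace ℝ E] [TopologicalSpace H]
    (J : ModelWithCorners ℝ E H) : Prop :=
  ∃ a : E →L[ℝ] ℝ, Set.range J = {x | 0 ≤ a x}

/-- An orientation of an `n`-dimensional smooth manifold: an orientation of every tangent space
that is locally constant in the standard trivializations of the tangent bundle. -/
structure ManifoldOrientation {n : ℕ} {H : Type*} [TopologicalSpace H]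
    (J : ModelWithCorners ℝ (EuclideanSpace ℝ (Fin n)) H)
    (M : Type*) [TopologicalSpace M] [ChartedSpace H M] [IsManifold J ∞ M] where
  /-- the orientation of the tangent space at a point -/
  at_ : ∀ x : M, Orientation ℝ (TangentSpace J x) (Fin n)
  /-- continuity of the orientation -/
  locally_constant : ∀ x : M, ∃ s : Orientation ℝ (EuclideanSpace ℝ (Fin n)) (Fin n),
    ∀ᶠ y in 𝓝 x, ∀ hy : y ∈ (trivializationAt (EuclideanSpace ℝ (Fin n))
        (TangentSpace J : M → Type _) x).baseSet,
      Orientation.map (Fin n) ((trivializationAt (EuclideanSpace ℝ (Fin n))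
        (TangentSpace J : M → Type _) x).linearEquivAt ℝ y hy) (at_ y) = s

/-- The family `v` is a basis that represents the orientation `o`. -/
def IsPositiveBasis {V : Type*} [AddCommGroup V] [Module ℝ V] {n : ℕ}
    (o : Orientation ℝ V (Fin n)) (v : Fin n → V) : Prop :=
  ∃ b : Module.Basis (Fin n) ℝ V, ⇑b = v ∧ b.orientation = o

/-- `γ : [0, 1] → ℂ` is a closed curve avoiding `0` with winding number `w` about `0`: it has a
continuous logarithm that increases by `2 π i w`. -/
def HasWindingNumber (γ : I → ℂ) (w : ℤ) : Prop :=
  ∃ θ : C(I, ℂ), (∀ t, Complex.exp (θ t) = γ t) ∧ θ 1 - θ 0 = 2 * Real.pi * Complex.I * w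

section Linking

variable {m : ℕ} {H H' : Type*} [TopologicalSpace H] [TopologicalSpace H']
  {J : ModelWithCorners ℝ (EuclideanSpace ℝ (Fin (m + 2))) H}
  {J' : ModelWithCorners ℝ (EuclideanSpace ℝ (Fin m)) H'}
  {M : Type*} [TopologicalSpace M] [ChartedSpace H M] [IsManifold J ∞ M]
  {K : Type*} [TopologicalSpace K] [ChartedSpace H' K] [IsManifold J' ∞ K]

/-- `K`, included in `M` by `f`, is a properly embedded codimension 2 submanifold: `f` is a smooth
embedding, is proper, and satisfies `∂K = K ∩ ∂M`. -/
structure IsProperlyEmbedded (J : ModelWithCorners ℝ (EuclideanSpace ℝ (Fin (m + 2))) H)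
    (J' : ModelWithCorners ℝ (EuclideanSpace ℝ (Fin m)) H') (f : K → M) : Prop where
  isSmoothEmbedding : Manifold.IsSmoothEmbedding J' J ∞ f
  isProperMap : IsProperMap f
  boundary_iff : ∀ k : K, f k ∈ J.boundary M ↔ k ∈ J'.boundary K

/-- `g : M → ℂ` is, on the open neighbourhood `U` of the point `f k` of `K`, an equation of `K`
in `M` that is compatible with the orientations: `g` is smooth on `U`, vanishes there exactly on
`K`, its differential at `f k` is onto, and the isomorphism of the normal space `T M / T K` at
`f k` with `ℂ` that it induces preserves orientations. Here the normal space is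
oriented so that an oriented basis of `T K` followed by an oriented basis of the normal
space is an oriented basis of `T M` (codimension 2 makes the order of the two irrelevant). -/
structure IsOrientedEquation (oM : ManifoldOrientation J M) (oK : ManifoldOrientation J' K)
    (f : K → M) (k : K) (U : Set M) (g : M → ℂ) : Prop where
  isOpen : IsOpen U
  mem : f k ∈ U
  smooth : ContMDiffOn J 𝓘(ℝ, ℂ) ∞ g U
  zero_iff : ∀ y ∈ U, g y = 0 ↔ y ∈ Set.range f
  surjective : Function.Surjective (mfderiv J 𝓘(ℝ, ℂ) g (f k))
  oriented : ∀ (b : Module.Basis (Fin m) ℝ (TangentSpace J' k)) (v₁ v₂ : TangentSpace J (f k)),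
    mfderiv J 𝓘(ℝ, ℂ) g (f k) v₁ = (1 : ℂ) → mfderiv J 𝓘(ℝ, ℂ) g (f k) v₂ = Complex.I →
      (IsPositiveBasis (oK.at_ k) b ↔
        IsPositiveBasis (oM.at_ (f k)) (Fin.append (fun i => mfderiv J' J f k (b i)) ![v₁, v₂]))

/-- The bounding circle of the noose `ν` has (signed) linking number `w` with `K`. As the disk of
the noose meets `K` only in the image of its center, this is the local intersection number
there of the disk with `K`: the winding number about `0` of the image of a small circle
around the center under an oriented equation of `K`. -/
def HasLinkingNumber (oM : ManifoldOrientation J M) (oK : ManifoldOrientation J' K)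
    (f : K → M) {p : M} (ν : Noose (Set.range f) p) (w : ℤ) : Prop :=
  ∃ (k : K) (U : Set M) (g : M → ℂ), f k = ν.1 NooseSpace.center ∧
    IsOrientedEquation oM oK f k U g ∧
    ∃ r : I, 0 < r ∧ (∀ z : NooseSpace, ‖(z : ℂ)‖ ≤ r → ν.1 z ∈ U) ∧
      HasWindingNumber (fun t => g (ν.1 (NooseSpace.diskPoint r t))) w

/-- The underlying set of the knot quandle `Q(M, K, p)`, a subset of the fundamental quandle
`Π(M, K, p)`: the classes of nooses whose bounding circle has linking number `1` with `K`. -/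
def knotQuandle (oM : ManifoldOrientation J M) (oK : ManifoldOrientation J' K)
    (f : K → M) (p : M) : Set (FundamentalQuandle (Set.range f) p) :=
  {q | ∃ ν : Noose (Set.range f) p,
    FundamentalQuandle.mk ν = q ∧ HasLinkingNumber oM oK f ν 1}

end Linking

end KnotQuandle

end

/-!
A loop `γ` in `M \ K` that is null-homotopic in `M` is recognized by a monodromy argument. The image
of `ℓ` is stable under conjugation, since a noose may be prolonged by a loop at `p`; it therefore
generates a normal subgroup `N`, and joining all points to `p` turns `γ ↦ γ N` into a cocycle on the
paths of `M \ K` with values in `π₁(M \ K, p) / N`. Away from `K` the cocycle has local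
potentials. Near a point of `K` the pair `(M, K)` is `(C × 𝔻, C × {0})` with `C` contractible, also
at the boundary, and the complement has the universal cover `C × (0, δ) × ℝ`, given by polar
coordinates; a potential upstairs descends because the cocycle is trivial on the meridian, which is
the circle of a noose with linking number `1`. So potentials exist near every point of `M`, not
only of `M \ K`: they are the local sections of a covering of `M`, in which the lift of `γ` is
closed. Hence the cocycle vanishes on `γ`, that is, `γ ∈ N`.
-/

noncomputable section

namespace KnotQuandle

open Set Filter

/-- A homotopy invariant assignment of group elements to the paths of a space that is compatible
with concatenation, in the order of multiplication of `FundamentalGroup.mul_def`. -/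
structure PathCocycle (A Γ : Type*) [TopologicalSpace A] [Group Γ] where
  val : ∀ {a b : A}, Path a b → Γ
  val_trans : ∀ {a b c : A} (α : Path a b) (β : Path b c), val (α.trans β) = val β * val α
  val_homotopic : ∀ {a b : A} {α β : Path a b}, α.Homotopic β → val α = val β

namespace PathCocycle

variable {A B Γ : Type*} [TopologicalSpace A] [TopologicalSpace B] [Group Γ]
  (F : PathCocycle A Γ)

lemma val_refl (a : A) : F.val (Path.refl a) = 1 := by
  have h := F.val_trans (Path.refl a) (Path.refl a)
  rwa [Path.refl_trans_refl, left_eq_mul] at h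

lemma val_congr {a b a' b' : A} (α : Path a b) (β : Path a' b') (h : ∀ t, α t = β t) :
    F.val α = F.val β := by
  obtain rfl : a = a' := by simpa using h 0
  obtain rfl : b = b' := by simpa using h 1
  exact congrArg F.val (Path.ext (funext h))

lemma val_subpath_mul {a b : A} (α : Path a b) (r s t : I) :
    F.val (α.subpath s t) * F.val (α.subpath r s) = F.val (α.subpath r t) := by
  rw [← F.val_trans]
  exact F.val_homotopic ⟨Path.Homotopy.subpathTransSubpath α r s t⟩

/-- The pullback of a path cocycle along a continuous map. -/
def comap (q : C(B, A)) : PathCocycle B Γ where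
  val α := F.val (α.map q.continuous)
  val_trans α β := by rw [Path.map_trans, F.val_trans]
  val_homotopic h := F.val_homotopic (h.map q)

/-- The function `τ` integrates the path cocycle `F` on the set `U`: the value of `F` on a path
in `U` is the quotient of the values of `τ` at its end points. -/
def IsPotentialOn (U : Set A) (τ : A → Γ) : Prop :=
  ∀ ⦃a b : A⦄ (α : Path a b), (∀ t, α t ∈ U) → F.val α * τ a = τ b

variable {F}

lemma IsPotentialOn.mono {U V : Set A} {τ : A → Γ} (h : F.IsPotentialOn V τ) (hUV : U ⊆ V) :
    F.IsPotentialOn U τ :=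
  fun _ _ α hα => h α fun t => hUV (hα t)

lemma IsPotentialOn.inv_mul_eq {U : Set A} (hU : IsPathConnected U) {ρ τ : A → Γ}
    (hρ : F.IsPotentialOn U ρ) (hτ : F.IsPotentialOn U τ) {a b : A} (ha : a ∈ U) (hb : b ∈ U) :
    (ρ a)⁻¹ * τ a = (ρ b)⁻¹ * τ b := by
  obtain ⟨γ, hγ⟩ := hU.joinedIn a ha b hb
  rw [← hρ γ hγ, ← hτ γ hγ]
  group

lemma exists_isPotentialOn_univ [SimplyConnectedSpace A] (F : PathCocycle A Γ) :
    ∃ τ, F.IsPotentialOn univ τ := by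
  obtain ⟨u⟩ : Nonempty A := inferInstance
  refine ⟨fun a => F.val (PathConnectedSpace.somePath u a), fun a b α _ => ?_⟩
  rw [← F.val_trans]
  exact F.val_homotopic (SimplyConnectedSpace.paths_homotopic _ _)

lemma IsPotentialOn.exists_of_comap {q : C(B, A)} {U : Set A} {τ : B → Γ}
    (hτ : (F.comap q).IsPotentialOn univ τ) (hq : τ.FactorsThrough q)
    (hlift : ∀ α : C(I, A), (∀ t, α t ∈ U) → ∃ β : C(I, B), q.comp β = α) :
    ∃ ρ, F.IsPotentialOn U ρ := by
  refine ⟨Function.extend q τ 1, fun a b α hα => ?_⟩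
  obtain ⟨β, hβ⟩ := hlift α hα
  have hβ' : ∀ t, q (β t) = α t := DFunLike.congr_fun hβ
  let β' : Path (β 0) (β 1) := ⟨β, rfl, rfl⟩
  have hval : (F.comap q).val β' = F.val α := F.val_congr _ _ hβ'
  have ha : Function.extend q τ 1 a = τ (β 0) := by
    rw [← α.source, ← hβ' 0, hq.extend_apply]
  have hb : Function.extend q τ 1 b = τ (β 1) := by
    rw [← α.target, ← hβ' 1, hq.extend_apply]
  rw [ha, hb, ← hval]
  exact hτ β' fun _ => mem_univ _

end PathCocycle

section Monodromy

lemma comap_nhds_neBot {A X : Type*} [TopologicalSpace X] {i : A → X} (hi : DenseRange i)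
    (x : X) : (comap i (𝓝 x)).NeBot :=
  comap_neBot_iff.2 fun W hW => by
    obtain ⟨-, hW, a, rfl⟩ := mem_closure_iff_nhds.1 (hi x) W hW
    exact ⟨a, hW⟩

lemma eventually_subpath_mem {A : Type*} [TopologicalSpace A] {a b : A} (α : Path a b) {s : I}
    {U : Set A} (hU : U ∈ 𝓝 (α s)) : ∀ᶠ t in 𝓝 s, ∀ u, α.subpath s t u ∈ U := by
  have hcont : Continuous fun q : I × I => α.subpath s q.1 q.2 :=
    α.subpath_continuous_family.comp (.prodMk continuous_const continuous_id)
  have hmem : ∀ u ∈ univ, ∀ᶠ q : I × I in 𝓝 (s, u), α.subpath s q.1 q.2 ∈ U := fun u _ =>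
    hcont.continuousAt (by simpa using hU)
  filter_upwards [isCompact_univ.eventually_forall_of_forall_eventually
    (P := fun t u => α.subpath s t u ∈ U) hmem] with t ht u using ht u (mem_univ u)

variable {A X Γ : Type*} [TopologicalSpace A] [TopologicalSpace X] [Group Γ]
  {i : A → X} {F : PathCocycle A Γ}

lemma pathConnectedSpace_of_isPathConnected_preimage [PreconnectedSpace X] [Nonempty X]
    (hconn : ∀ x : X, ∀ W ∈ 𝓝 x, ∃ V ∈ 𝓝 x, V ⊆ W ∧ IsPathConnected (i ⁻¹' V)) :
    PathConnectedSpace A := by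
  choose V hV _ hVc using fun x => hconn x univ univ_mem
  choose c hc using fun x => (hVc x).nonempty
  have hloc : IsLocallyConstant fun x => (⟦c x⟧ : ZerothHomotopy A) := by
    refine IsLocallyConstant.iff_eventually_eq _ |>.2 fun x => ?_
    filter_upwards [eventually_mem_nhds_iff.2 (hV x)] with y hy
    obtain ⟨W, -, hW, hWc⟩ := hconn y (V x ∩ V y) (inter_mem hy (hV y))
    obtain ⟨a, ha⟩ := hWc.nonempty
    exact Quotient.sound (((hVc y).joinedIn _ (hc y) a (hW ha).2).joined.trans
      ((hVc x).joinedIn a (hW ha).1 _ (hc x)).joined)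
  have hjoin : ∀ a, Joined a (c (i a)) := fun a =>
    ((hVc (i a)).joinedIn a (show i a ∈ _ from mem_of_mem_nhds (hV (i a))) _
      (hc (i a))).joined
  refine ⟨(inferInstance : Nonempty X).map c, fun a b => ?_⟩
  exact (hjoin a).trans ((Quotient.exact (hloc.apply_eq_of_preconnectedSpace _ _)).trans
    (hjoin b).symm)

/-- An open cover of `X` together with potentials of the path cocycle `F` on the preimages of its
members, and with the locally constant functions by which these potentials differ. The charts and
potentials are indexed by the points of `X`, as preferred charts around these points. -/
structure PotentialAtlas (F : PathCocycle A Γ) (i : A → X) where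
  chart : X → Set X
  isOpen_chart : ∀ x, IsOpen (chart x)
  mem_chart : ∀ x, x ∈ chart x
  potential : X → A → Γ
  isPotentialOn : ∀ x, F.IsPotentialOn (i ⁻¹' chart x) (potential x)
  transition : X → X → X → Γ
  eventually_eq_transition : ∀ j k x, x ∈ chart j ∩ chart k →
    ∀ᶠ a in comap i (𝓝 x), (potential k a)⁻¹ * potential j a = transition j k x

namespace PotentialAtlas

lemma nonempty
    (hconn : ∀ x : X, ∀ W ∈ 𝓝 x, ∃ V ∈ 𝓝 x, V ⊆ W ∧ IsPathConnected (i ⁻¹' V))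
    (hpot : ∀ x : X, ∃ V ∈ 𝓝 x, ∃ τ, F.IsPotentialOn (i ⁻¹' V) τ) :
    Nonempty (PotentialAtlas F i) := by
  choose V hV τ hτ using hpot
  have htransition : ∀ j k x, ∃ g : Γ, x ∈ interior (V j) ∩ interior (V k) →
      ∀ᶠ a in comap i (𝓝 x), (τ k a)⁻¹ * τ j a = g := by
    intro j k x
    by_cases hx : x ∈ interior (V j) ∩ interior (V k)
    · obtain ⟨W, hWx, hW, hWc⟩ := hconn x (V j ∩ V k)
        (inter_mem (mem_interior_iff_mem_nhds.1 hx.1) (mem_interior_iff_mem_nhds.1 hx.2))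
      obtain ⟨c, hc⟩ := hWc.nonempty
      refine ⟨(τ k c)⁻¹ * τ j c, fun _ => ?_⟩
      filter_upwards [preimage_mem_comap hWx] with a ha
      exact ((hτ k).mono fun _ hz => (hW hz).2).inv_mul_eq hWc
        ((hτ j).mono fun _ hz => (hW hz).1) ha hc
    · exact ⟨1, fun h => absurd h hx⟩
  choose g hg using htransition
  exact ⟨{
    chart := fun x => interior (V x)
    isOpen_chart := fun _ => isOpen_interior
    mem_chart := fun x => mem_interior_iff_mem_nhds.2 (hV x)
    potential := τ
    isPotentialOn := fun x => (hτ x).mono (preimage_mono interior_subset)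
    transition := g
    eventually_eq_transition := hg }⟩

variable (P : PotentialAtlas F i)

lemma transition_apply {j k : X} {a : A} (ha : i a ∈ P.chart j ∩ P.chart k) :
    P.transition j k (i a) = (P.potential k a)⁻¹ * P.potential j a :=
  ((eventually_comap.1 (P.eventually_eq_transition j k _ ha)).self_of_nhds a rfl).symm

lemma transition_self (hi : DenseRange i) {j x : X} (hx : x ∈ P.chart j) :
    P.transition j j x = 1 := by
  have := comap_nhds_neBot hi x
  obtain ⟨a, ha⟩ := (P.eventually_eq_transition j j x ⟨hx, hx⟩).exists
  rw [← ha, inv_mul_cancel]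

lemma transition_mul (hi : DenseRange i) {j k l x : X} (hj : x ∈ P.chart j) (hk : x ∈ P.chart k)
    (hl : x ∈ P.chart l) : P.transition k l x * P.transition j k x = P.transition j l x := by
  have := comap_nhds_neBot hi x
  obtain ⟨a, ha, ha', ha''⟩ := ((P.eventually_eq_transition j k x ⟨hj, hk⟩).and
    ((P.eventually_eq_transition k l x ⟨hk, hl⟩).and
      (P.eventually_eq_transition j l x ⟨hj, hl⟩))).exists
  rw [← ha, ← ha', ← ha'']
  group

lemma eventually_transition_eq (hi : DenseRange i) {j k x : X}
    (hx : x ∈ P.chart j ∩ P.chart k) : ∀ᶠ y in 𝓝 x, P.transition j k y = P.transition j k x := by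
  filter_upwards [(eventually_comap.1 (P.eventually_eq_transition j k x hx)).eventually_nhds,
    ((P.isOpen_chart j).inter (P.isOpen_chart k)).mem_nhds hx] with y hy hyjk
  have := comap_nhds_neBot hi y
  obtain ⟨a, ha, ha'⟩ := ((P.eventually_eq_transition j k y hyjk).and
    (eventually_comap.2 hy)).exists
  exact ha.symm.trans ha'

variable [TopologicalSpace Γ] [DiscreteTopology Γ]

/-- The covering space of `X` with fibre `Γ` that is glued from the charts of the atlas by left
multiplication with the transition functions. Its monodromy along the image of a path of `A` is
the value of the path cocycle. -/
def core (hi : DenseRange i) : FiberBundleCore X X Γ where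
  baseSet := P.chart
  isOpen_baseSet := P.isOpen_chart
  indexAt := id
  mem_baseSet_at := P.mem_chart
  coordChange j k x v := P.transition j k x * v
  coordChange_self j x hx v := by rw [P.transition_self hi hx, one_mul]
  continuousOn_coordChange j k := by
    rintro ⟨x, v⟩ ⟨hx, -⟩
    have hcont : ContinuousAt (fun q : X × Γ => P.transition j k x * q.2) (x, v) :=
      ((continuous_of_discreteTopology (f := fun w : Γ => P.transition j k x * w)).comp
        continuous_snd).continuousAt
    refine (hcont.congr ?_).continuousWithinAt
    filter_upwards [continuous_fst.continuousAt.eventually (P.eventually_transition_eq hi hx)]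
      with q hq
    rw [hq]
  coordChange_comp j k l x hx v := by
    rw [← mul_assoc, P.transition_mul hi hx.1.1 hx.1.2 hx.2]

/-- The point over `i a` of the covering space of an atlas whose coordinate with respect to the
potential of each chart around `i a` is the quotient of `w` by the value of the potential. -/
def corePoint (hi : DenseRange i) (a : A) (w : Γ) : (P.core hi).TotalSpace :=
  ⟨i a, (P.potential (i a) a)⁻¹ * w⟩

lemma corePoint_injective (hi : DenseRange i) (a : A) : Function.Injective (P.corePoint hi a) :=
  fun _ _ h => mul_left_cancel (eq_of_heq (Bundle.TotalSpace.mk.inj h).2)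

lemma localTriv_corePoint (hi : DenseRange i) {j : X} {a : A} (ha : i a ∈ P.chart j) (w : Γ) :
    (P.core hi).localTriv j (P.corePoint hi a w) = (i a, (P.potential j a)⁻¹ * w) := by
  refine Prod.ext rfl ?_
  change P.transition (i a) j (i a) * ((P.potential (i a) a)⁻¹ * w) = _
  rw [P.transition_apply ⟨P.mem_chart _, ha⟩]
  group

lemma continuous_corePoint_path (hi : DenseRange i) (hcont : Continuous i) {a b : A}
    (α : Path a b) :
    Continuous fun t => P.corePoint hi (α t) (F.val (α.subpath 0 t)) := by
  refine continuous_iff_continuousAt.2 fun s => ?_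
  have hiα : Continuous fun t => i (α t) := hcont.comp α.continuous
  refine (FiberBundle.continuousAt_totalSpace _ _).2 ⟨hiα.continuousAt, ?_⟩
  set j := i (α s)
  have hj : i ⁻¹' P.chart j ∈ 𝓝 (α s) :=
    hcont.continuousAt.preimage_mem_nhds ((P.isOpen_chart j).mem_nhds (P.mem_chart j))
  refine (continuousAt_const (y := (P.potential j (α s))⁻¹ * F.val (α.subpath 0 s))).congr ?_
  filter_upwards [eventually_subpath_mem α hj] with t ht
  have htj : i (α t) ∈ P.chart j := by simpa using ht 1
  change _ = ((P.core hi).localTriv j (P.corePoint hi (α t) _)).2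
  rw [P.localTriv_corePoint hi htj, ← F.val_subpath_mul α 0 s t, ← P.isPotentialOn j _ ht]
  group

end PotentialAtlas

theorem PathCocycle.val_eq_one_of_homotopic_refl (hcont : Continuous i)
    (hconn : ∀ x : X, ∀ W ∈ 𝓝 x, ∃ V ∈ 𝓝 x, V ⊆ W ∧ IsPathConnected (i ⁻¹' V))
    (hpot : ∀ x : X, ∃ V ∈ 𝓝 x, ∃ τ, F.IsPotentialOn (i ⁻¹' V) τ)
    {a : A} (α : Path a a) (hα : (α.map hcont).Homotopic (Path.refl (i a))) : F.val α = 1 := by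
  let _ : TopologicalSpace Γ := ⊥
  have _ : DiscreteTopology Γ := ⟨rfl⟩
  have hi : DenseRange i := fun x => mem_closure_iff_nhds.2 fun W hW => by
    obtain ⟨V, -, hVW, hV⟩ := hconn x W hW
    obtain ⟨c, hc⟩ := hV.nonempty
    exact ⟨i c, hVW hc, mem_range_self c⟩
  obtain ⟨P⟩ := PotentialAtlas.nonempty hconn hpot
  have hcov : IsCoveringMap (P.core hi).proj := FiberBundle.isCoveringMap
  have hsource : P.corePoint hi (α 0) (F.val (α.subpath 0 0)) = P.corePoint hi a 1 := by
    rw [Path.subpath_self, F.val_refl, α.source]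
  have htarget : P.corePoint hi (α 1) (F.val (α.subpath 0 1)) = P.corePoint hi a (F.val α) := by
    rw [F.val_congr (α.subpath 0 1) α (by simp [Path.subpath_zero_one]), α.target]
  let lift : Path (P.corePoint hi a 1) (P.corePoint hi a (F.val α)) :=
    ⟨⟨_, P.continuous_corePoint_path hi hcont α⟩, hsource, htarget⟩
  have hmonodromy := hcov.monodromy_eq_of_map_eq (γ := .mk (α.map hcont))
    (ex := ⟨P.corePoint hi a 1, rfl⟩) (ey := ⟨P.corePoint hi a (F.val α), rfl⟩) (.mk lift) rfl
  rw [Path.Homotopic.Quotient.eq.2 hα, Path.Homotopic.Quotient.mk_refl,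
    hcov.monodromy_refl] at hmonodromy
  exact (P.corePoint_injective hi a (congrArg Subtype.val hmonodromy)).symm

end Monodromy

section Noose

lemma starConvex_nooseSet : StarConvex ℝ 0 nooseSet := by
  refine starConvex_zero_iff.2 ?_
  rintro _ (hz | ⟨a, b, ha, hb, hab, rfl⟩) t ht0 ht1
  · exact .inl ((convex_closedBall (0 : ℂ) 1).starConvex (by simp) |>.smul_mem hz ht0 ht1)
  · have hz : t • (a • (1 : ℂ) + b • 2) = (t * (1 + b) : ℝ) := by
      rw [eq_sub_of_add_eq hab]
      simp only [Complex.real_smul]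
      push_cast
      ring
    rw [hz]
    rcases le_total (t * (1 + b)) 1 with h | h
    · refine .inl (mem_closedBall_zero_iff.2 ?_)
      rwa [Complex.norm_real, Real.norm_of_nonneg (by positivity)]
    · refine .inr ⟨2 - t * (1 + b), t * (1 + b) - 1, by nlinarith, by linarith, by ring, ?_⟩
      simp only [Complex.real_smul]
      push_cast
      ring

instance NooseSpace.contractibleSpace : ContractibleSpace NooseSpace :=
  starConvex_nooseSet.contractibleSpace ⟨0, NooseSpace.center.2⟩

lemma NooseSpace.norm_le_two (z : NooseSpace) : ‖(z : ℂ)‖ ≤ 2 := by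
  have hsub : nooseSet ⊆ Metric.closedBall 0 2 :=
    union_subset (Metric.closedBall_subset_closedBall one_le_two)
      ((convex_closedBall (0 : ℂ) 2).segment_subset (by simp) (by simp))
  exact mem_closedBall_zero_iff.1 (hsub z.2)

lemma NooseSpace.norm_le_one_of_re_le_one {z : NooseSpace} (hz : (z : ℂ).re ≤ 1) :
    ‖(z : ℂ)‖ ≤ 1 := by
  rcases z.2 with hdisk | ⟨a, b, -, hb, hab, hsegment⟩
  · exact mem_closedBall_zero_iff.1 hdisk
  · rw [← hsegment] at hz ⊢
    replace hz : a + b * 2 ≤ 1 := by simpa using hz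
    obtain rfl : b = 0 := by linarith
    obtain rfl : a = 1 := by linarith
    simp

lemma NooseSpace.eq_arcPoint_one {z : NooseSpace} (hz : (z : ℂ).re = 1) : z = arcPoint 1 := by
  have hnorm : |(z : ℂ).re| = ‖(z : ℂ)‖ :=
    le_antisymm (Complex.abs_re_le_norm _) (by simpa [hz] using norm_le_one_of_re_le_one hz.le)
  refine Subtype.ext (Complex.ext ?_ ?_)
  · norm_num [hz, arcPoint]
  · simp [Complex.abs_re_eq_norm.1 hnorm, arcPoint]

lemma NooseSpace.norm_diskPoint (r t : I) : ‖(diskPoint r t : ℂ)‖ = r := by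
  have hexp : ‖Complex.exp (2 * Real.pi * Complex.I * (t : ℝ))‖ = 1 := by
    rw [Complex.norm_exp]
    simp
  simp [diskPoint, hexp, abs_of_nonneg r.2.1]

lemma NooseSpace.re_diskPoint_le (r t : I) : (diskPoint r t : ℂ).re ≤ 1 :=
  (Complex.re_le_norm _).trans ((norm_diskPoint r t).trans_le r.2.2)

variable {X : Type*} [TopologicalSpace X] {S : Set X} {p c : X} (hp : p ∉ S)

lemma Noose.map_canonicalLoop_homotopic_refl (ν : Noose S p) :
    ((ν.canonicalLoop hp).map continuous_subtype_val).Homotopic (Path.refl p) := by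
  obtain ⟨ν, rfl, hν⟩ := ν
  let arc : Path NooseSpace.base (NooseSpace.arcPoint 1) :=
    ⟨⟨_, NooseSpace.continuous_arcPoint⟩, NooseSpace.arcPoint_zero, rfl⟩
  let circle : Path (NooseSpace.arcPoint 1) (NooseSpace.arcPoint 1) :=
    ⟨⟨_, NooseSpace.continuous_diskPoint 1⟩, NooseSpace.diskPoint_one_zero,
      NooseSpace.diskPoint_one_one⟩
  have h : ((arc.trans circle).trans arc.symm).Homotopic (Path.refl _) :=
    SimplyConnectedSpace.paths_homotopic _ _
  have hloop : (Noose.canonicalLoop hp ⟨ν, rfl, hν⟩).map continuous_subtype_val =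
      ((arc.trans circle).trans arc.symm).map ν.continuous := by
    simp only [Noose.canonicalLoop, Path.map_trans]
    rfl
  rw [hloop]
  exact h.map ν

/-- The noose with the same disk as `ν` and with the arc `α`. -/
def Noose.withArc (ν : Noose S c)
    (α : Path (⟨p, hp⟩ : (Sᶜ : Set X)) (ν.eval (.arcPoint 1) (NooseSpace.arcPoint_ne_center 1))) :
    Noose S p where
  val :=
    { toFun z := if (z : ℂ).re ≤ 1 then ν.1 z else α.extend (2 - (z : ℂ).re)
      continuous_toFun := by
        refine Continuous.if_le ν.1.continuous ?_
          (Complex.continuous_re.comp continuous_subtype_val) continuous_const ?_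
        · fun_prop
        · intro z hz
          rw [hz, NooseSpace.eq_arcPoint_one hz]
          norm_num [Noose.eval] }
  property := by
    refine ⟨?_, fun z => ?_⟩
    · norm_num [NooseSpace.base]
    · by_cases hz : (z : ℂ).re ≤ 1
      · simpa [hz] using ν.2.2 z
      · have hz0 : z ≠ NooseSpace.center := by
          rintro rfl
          norm_num [NooseSpace.center] at hz
        refine iff_of_false (fun h => (α.extend (2 - (z : ℂ).re)).2 ?_) hz0
        simpa only [ContinuousMap.coe_mk, if_neg hz] using h

lemma Noose.withArc_apply_of_re_le (ν : Noose S c)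
    (α : Path (⟨p, hp⟩ : (Sᶜ : Set X)) (ν.eval (.arcPoint 1) (NooseSpace.arcPoint_ne_center 1)))
    {z : NooseSpace} (hz : (z : ℂ).re ≤ 1) : (ν.withArc hp α).1 z = ν.1 z :=
  if_pos hz

lemma Noose.withArc_arcPoint (ν : Noose S c)
    (α : Path (⟨p, hp⟩ : (Sᶜ : Set X)) (ν.eval (.arcPoint 1) (NooseSpace.arcPoint_ne_center 1)))
    (t : I) : (ν.withArc hp α).1 (.arcPoint t) = α t := by
  have hre : (NooseSpace.arcPoint t : ℂ).re = 2 - t := by simp [NooseSpace.arcPoint]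
  rcases t.2.2.lt_or_eq with ht | ht
  · have h : ¬ (NooseSpace.arcPoint t : ℂ).re ≤ 1 := by linarith
    refine (if_neg h).trans ?_
    rw [hre, sub_sub_cancel, Path.extend_apply _ t.2]
  · obtain rfl : t = 1 := Subtype.ext ht
    rw [ν.withArc_apply_of_re_le hp α (by norm_num [hre]), α.target]
    rfl

lemma augmentation_withArc (ν : Noose S c)
    (α : Path (⟨p, hp⟩ : (Sᶜ : Set X)) (ν.eval (.arcPoint 1) (NooseSpace.arcPoint_ne_center 1))) :
    augmentation S p hp (.mk (ν.withArc hp α)) =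
      FundamentalGroup.fromPath (.mk ((α.trans ν.circle).trans α.symm)) := by
  have harc : ∀ t, (ν.withArc hp α).arc hp t = α t := fun t =>
    Subtype.ext (ν.withArc_arcPoint hp α t)
  have hcircle : ∀ t, (ν.withArc hp α).circle t = ν.circle t := fun t =>
    Subtype.ext (ν.withArc_apply_of_re_le hp α (NooseSpace.re_diskPoint_le 1 t))
  have hloop : (ν.withArc hp α).canonicalLoop hp = (α.trans ν.circle).trans α.symm := by
    ext t
    simp only [Noose.canonicalLoop, Path.trans_apply, Path.symm_apply, Function.comp_apply, harc,
      hcircle]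
  exact congrArg (fun γ => FundamentalGroup.fromPath (.mk γ)) hloop

end Noose

lemma normal_closure_of_conj_mem {G : Type*} [Group G] {s : Set G}
    (hs : ∀ x ∈ s, ∀ g, g * x * g⁻¹ ∈ s) : (Subgroup.closure s).Normal := by
  have hnormalizer : Subgroup.normalizer s = ⊤ := by
    refine eq_top_iff.2 fun g _ => Subgroup.mem_set_normalizer_iff.2 fun x =>
      ⟨fun hx => hs x hx g, fun hx => ?_⟩
    simpa [mul_assoc] using hs _ hx g⁻¹
  exact Subgroup.normalizer_eq_top_iff.1
    (top_le_iff.1 (hnormalizer ▸ Subgroup.normalizer_le_normalizer_closure _))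

section Quandle

variable {m : ℕ} {H H' : Type*} [TopologicalSpace H] [TopologicalSpace H']
  {J : ModelWithCorners ℝ (EuclideanSpace ℝ (Fin (m + 2))) H}
  {J' : ModelWithCorners ℝ (EuclideanSpace ℝ (Fin m)) H'}
  {M : Type*} [TopologicalSpace M] [ChartedSpace H M] [IsManifold J ∞ M]
  {K : Type*} [TopologicalSpace K] [ChartedSpace H' K] [IsManifold J' ∞ K]
  {oM : ManifoldOrientation J M} {oK : ManifoldOrientation J' K} {f : K → M} {p c : M}
  (hp : p ∉ range f)

lemma HasLinkingNumber.withArc {ν : Noose (range f) c} {w : ℤ}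
    (hν : HasLinkingNumber oM oK f ν w)
    (α : Path (⟨p, hp⟩ : ((range f)ᶜ : Set M))
      (ν.eval (.arcPoint 1) (NooseSpace.arcPoint_ne_center 1))) :
    HasLinkingNumber oM oK f (ν.withArc hp α) w := by
  obtain ⟨k, U, g, hk, hg, r, hr, hU, hw⟩ := hν
  have hre {z : NooseSpace} (hz : ‖(z : ℂ)‖ ≤ r) : (z : ℂ).re ≤ 1 :=
    (Complex.re_le_norm _).trans (hz.trans r.2.2)
  have heq {z : NooseSpace} (hz : ‖(z : ℂ)‖ ≤ r) : (ν.withArc hp α).1 z = ν.1 z :=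
    ν.withArc_apply_of_re_le hp α (hre hz)
  refine ⟨k, U, g, ?_, hg, r, hr, fun z hz => (heq hz).symm ▸ hU z hz, ?_⟩
  · rw [hk, heq (by simp [NooseSpace.center, r.2.1])]
  · simpa only [heq (NooseSpace.norm_diskPoint r _).le] using hw

lemma fromPath_circle_conj_mem_closure {ν : Noose (range f) c} (hν : HasLinkingNumber oM oK f ν 1)
    (α : Path (⟨p, hp⟩ : ((range f)ᶜ : Set M))
      (ν.eval (.arcPoint 1) (NooseSpace.arcPoint_ne_center 1))) :
    FundamentalGroup.fromPath (.mk ((α.trans ν.circle).trans α.symm)) ∈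
      Subgroup.closure (augmentation (range f) p hp '' knotQuandle oM oK f p) :=
  Subgroup.subset_closure ⟨_, ⟨_, rfl, hν.withArc hp α⟩, augmentation_withArc hp ν α⟩

lemma conj_mem_augmentation_image (g : FundamentalGroup ((range f)ᶜ : Set M) ⟨p, hp⟩) {x}
    (hx : x ∈ augmentation (range f) p hp '' knotQuandle oM oK f p) :
    g * x * g⁻¹ ∈ augmentation (range f) p hp '' knotQuandle oM oK f p := by
  obtain ⟨_, ⟨ν, rfl, hν⟩, rfl⟩ := hx
  obtain ⟨γ, rfl⟩ := Path.Homotopic.Quotient.mk_surjective g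
  refine ⟨_, ⟨_, rfl, hν.withArc hp (γ.symm.trans (ν.arc hp))⟩,
    (augmentation_withArc hp _ _).trans ?_⟩
  change _ = (Path.Homotopic.Quotient.mk γ).symm.trans
    ((Path.Homotopic.Quotient.mk (ν.canonicalLoop hp)).trans (.mk γ))
  simp only [Noose.canonicalLoop, Path.trans_symm, Path.symm_symm, Path.Homotopic.Quotient.mk_trans,
    Path.Homotopic.Quotient.mk_symm, Path.Homotopic.Quotient.trans_assoc]

lemma normal_closure_augmentation_image :
    (Subgroup.closure (augmentation (range f) p hp '' knotQuandle oM oK f p)).Normal :=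
  normal_closure_of_conj_mem fun _ hx g => conj_mem_augmentation_image hp g hx

end Quandle

/-- A slice chart of the subset `S` of the space `X`: a homeomorphism of `V` with the product of `C`
and the open disk of radius `δ` that maps `S` to `C × {0}`. -/
structure SliceChart {X : Type*} [TopologicalSpace X] (S V : Set X) (C : Type*)
    [TopologicalSpace C] (δ : ℝ) where
  toHomeomorph : V ≃ₜ C × Metric.ball (0 : ℂ) δ
  mem_iff : ∀ x : V, (x : X) ∈ S ↔ ((toHomeomorph x).2 : ℂ) = 0
  radius_pos : 0 < δ

namespace SliceChart

variable {X C Γ : Type*} [TopologicalSpace X] [TopologicalSpace C] [Group Γ] {S V : Set X} {δ : ℝ}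
  (φ : SliceChart S V C δ)

lemma symm_mem_iff (c : C) (z : Metric.ball (0 : ℂ) δ) :
    (φ.toHomeomorph.symm (c, z) : X) ∈ S ↔ (z : ℂ) = 0 := by
  rw [φ.mem_iff, Homeomorph.apply_symm_apply]

/-- Polar coordinates in the disk factor, as a covering of the complement of `S` in a slice
chart. -/
def polar : C(C × Ioo 0 δ × ℝ, (Sᶜ : Set X)) where
  toFun u := ⟨φ.toHomeomorph.symm (u.1, ⟨(u.2.1 : ℝ) * Circle.exp u.2.2, by
    simpa [abs_of_pos u.2.1.2.1] using u.2.1.2.2⟩), by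
      simp [symm_mem_iff, u.2.1.2.1.ne']⟩
  continuous_toFun := by fun_prop

lemma polar_eq_iff {u v : C × Ioo 0 δ × ℝ} :
    φ.polar u = φ.polar v ↔
      u.1 = v.1 ∧ u.2.1 = v.2.1 ∧ ∃ n : ℤ, u.2.2 = v.2.2 + n * (2 * Real.pi) := by
  obtain ⟨c, r, y⟩ := u
  obtain ⟨c', r', y'⟩ := v
  rw [Subtype.ext_iff, ← Circle.exp_eq_exp]
  simp only [polar, ContinuousMap.coe_mk, SetCoe.ext_iff, EmbeddingLike.apply_eq_iff_eq,
    Prod.mk.injEq, Subtype.mk.injEq]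
  refine and_congr_right' ⟨fun h => ?_, fun h => by rw [h.1, h.2]⟩
  have hr : (r : ℝ) = r' := by
    simpa [abs_of_pos r.2.1, abs_of_pos r'.2.1] using congrArg norm h
  refine ⟨Subtype.ext hr, Circle.ext (mul_left_cancel₀ (Complex.ofReal_ne_zero.2 r'.2.1.ne') ?_)⟩
  rwa [hr] at h

lemma polar_eq {a : (Sᶜ : Set X)} (ha : (a : X) ∈ V) {r : Ioo 0 δ} {y : ℝ}
    (h : (r * Circle.exp y : ℂ) = (φ.toHomeomorph ⟨a, ha⟩).2) :
    φ.polar ((φ.toHomeomorph ⟨a, ha⟩).1, r, y) = a := by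
  have hz : (⟨r * Circle.exp y, h ▸ (φ.toHomeomorph ⟨a, ha⟩).2.2⟩ : Metric.ball (0 : ℂ) δ) =
      (φ.toHomeomorph ⟨a, ha⟩).2 := Subtype.ext h
  refine Subtype.ext ?_
  simp only [polar, ContinuousMap.coe_mk, hz, Prod.mk.eta, Homeomorph.symm_apply_apply]

lemma norm_mem_Ioo {a : (Sᶜ : Set X)} (ha : (a : X) ∈ V) :
    ‖((φ.toHomeomorph ⟨a, ha⟩).2 : ℂ)‖ ∈ Ioo 0 δ :=
  ⟨norm_pos_iff.2 fun h => a.2 ((φ.mem_iff _).2 h),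
    mem_ball_zero_iff.1 (φ.toHomeomorph ⟨a, ha⟩).2.2⟩

lemma range_polar : range φ.polar = Subtype.val ⁻¹' V := by
  refine Subset.antisymm (range_subset_iff.2 fun _ => Subtype.coe_prop (S := V) _) fun a ha => ?_
  refine ⟨_, φ.polar_eq ha (r := ⟨_, φ.norm_mem_Ioo ha⟩)
    (y := Complex.arg (φ.toHomeomorph ⟨a, ha⟩).2) ?_⟩
  rw [Circle.coe_exp, Complex.norm_mul_exp_arg_mul_I]

lemma exists_polar_comp_eq (α : C(I, (Sᶜ : Set X))) (hα : ∀ t, α t ∈ Subtype.val ⁻¹' V) :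
    ∃ β : C(I, C × Ioo 0 δ × ℝ), φ.polar.comp β = α := by
  let z : C(I, C × Metric.ball (0 : ℂ) δ) :=
    ⟨fun t => φ.toHomeomorph ⟨α t, hα t⟩, by fun_prop⟩
  let w : C(I, {z : ℂ // z ≠ 0}) :=
    ⟨fun t => ⟨(z t).2, norm_pos_iff.1 (φ.norm_mem_Ioo (hα t)).1⟩, by fun_prop⟩
  obtain ⟨θ, hθ, -⟩ := Complex.isCoveringMap_exp.exists_path_lifts w (Complex.log (w 0))
    (Subtype.ext (Complex.exp_log (w 0).2).symm)
  refine ⟨⟨fun t => ((z t).1, ⟨‖((z t).2 : ℂ)‖, φ.norm_mem_Ioo (hα t)⟩, (θ t).im), by fun_prop⟩,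
    ContinuousMap.ext fun t => φ.polar_eq (hα t) ?_⟩
  have hpolar : (‖Complex.exp (θ t)‖ * Circle.exp (θ t).im : ℂ) = Complex.exp (θ t) := by
    rw [Complex.norm_exp, Circle.coe_exp, Complex.ofReal_exp, ← Complex.exp_add, Complex.re_add_im]
  have hexp : Complex.exp (θ t) = (φ.toHomeomorph ⟨α t, hα t⟩).2 :=
    congrArg Subtype.val (congrFun hθ t)
  rwa [hexp] at hpolar

/-- The scaling of the noose by `δ / 3`, as a map to the disk of a slice chart. -/
def scale : C(NooseSpace, Metric.ball (0 : ℂ) δ) where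
  toFun z := ⟨z * (δ / 3 : ℝ), by
    have hδ := φ.radius_pos
    rw [mem_ball_zero_iff, norm_mul, Complex.norm_real, Real.norm_of_nonneg (by positivity)]
    nlinarith [z.norm_le_two]⟩
  continuous_toFun := by fun_prop

/-- The meridian disk of `S` at the point `c` of the slice `C × {0}`, extended to a noose. -/
def noose (c : C) : Noose S (φ.toHomeomorph.symm (c, φ.scale .base) : X) where
  val := ⟨fun z => φ.toHomeomorph.symm (c, φ.scale z), by fun_prop⟩
  property := by
    refine ⟨rfl, fun z => ?_⟩
    simp [symm_mem_iff, scale, φ.radius_pos.ne', NooseSpace.center, Subtype.ext_iff]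

variable [ContractibleSpace C] {F : PathCocycle (Sᶜ : Set X) Γ}

lemma contractibleSpace_polar (φ : SliceChart S V C δ) : ContractibleSpace (C × Ioo 0 δ × ℝ) :=
  have : ContractibleSpace (Ioo 0 δ) :=
    (convex_Ioo 0 δ).contractibleSpace (nonempty_Ioo.2 φ.radius_pos)
  inferInstance

lemma isPathConnected_preimage (φ : SliceChart S V C δ) :
    IsPathConnected (Subtype.val ⁻¹' V : Set (Sᶜ : Set X)) := by
  have := φ.contractibleSpace_polar
  rw [← φ.range_polar]
  exact isPathConnected_range φ.polar.continuous

lemma apply_add_two_pi {τ : C × Ioo 0 δ × ℝ → Γ}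
    (hτ : (F.comap φ.polar).IsPotentialOn univ τ) {c₀ : C} (hF : F.val (φ.noose c₀).circle = 1)
    (c : C) (r : Ioo 0 δ) (y : ℝ) : τ (c, r, y + 2 * Real.pi) = τ (c, r, y) := by
  have := φ.contractibleSpace_polar
  have hδ := φ.radius_pos
  let r₀ : Ioo 0 δ := ⟨δ / 3, by positivity, by linarith⟩
  have hbase : τ (c₀, r₀, 2 * Real.pi) = τ (c₀, r₀, 0) := by
    let β : Path ((c₀, r₀, 0) : C × Ioo 0 δ × ℝ) (c₀, r₀, 2 * Real.pi) :=
      { toFun t := (c₀, r₀, 2 * Real.pi * t)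
        continuous_toFun := by fun_prop
        source' := by simp
        target' := by simp }
    have hβ : (F.comap φ.polar).val β = 1 := by
      rw [← hF]
      refine F.val_congr _ _ fun t => Subtype.ext ?_
      refine congrArg (fun z => (φ.toHomeomorph.symm (c₀, z) : X)) (Subtype.ext ?_)
      simp [β, r₀, scale, NooseSpace.diskPoint, Circle.coe_exp, mul_comm, mul_left_comm]
    rw [← hτ β fun _ => mem_univ _, hβ, one_mul]
  let T : C(C × Ioo 0 δ × ℝ, C × Ioo 0 δ × ℝ) :=
    ⟨fun u => (u.1, u.2.1, u.2.2 + 2 * Real.pi), by fun_prop⟩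
  have hT (u) : φ.polar (T u) = φ.polar u := φ.polar_eq_iff.2 ⟨rfl, rfl, 1, by simp [T]⟩
  let γ := PathConnectedSpace.somePath (c₀, r₀, (0 : ℝ)) (c, r, y)
  have hTγ : (F.comap φ.polar).val (γ.map T.continuous) = (F.comap φ.polar).val γ :=
    F.val_congr _ _ fun t => hT (γ t)
  change τ (T (c, r, y)) = _
  rw [← hτ (γ.map T.continuous) fun _ => mem_univ _, ← hτ γ fun _ => mem_univ _, hTγ]
  congr 1
  simpa [T] using hbase

lemma exists_isPotentialOn {c : C} (hF : F.val (φ.noose c).circle = 1) :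
    ∃ τ, F.IsPotentialOn (Subtype.val ⁻¹' V) τ := by
  have := φ.contractibleSpace_polar
  obtain ⟨τ, hτ⟩ := PathCocycle.exists_isPotentialOn_univ (F.comap φ.polar)
  refine hτ.exists_of_comap (fun u v huv => ?_) φ.exists_polar_comp_eq
  obtain ⟨c', r, y⟩ := u
  obtain ⟨rfl, rfl, n, rfl⟩ := φ.polar_eq_iff.1 huv
  have hperiodic : Function.Periodic (fun y => τ (v.1, v.2.1, y)) (2 * Real.pi) :=
    φ.apply_add_two_pi hτ hF v.1 v.2.1
  exact hperiodic.int_mul n v.2.2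

end SliceChart

section Tube

open Metric

variable {E F : Type*} [NormedAddCommGroup E] [NormedSpace ℝ E] [NormedAddCommGroup F]
  [NormedSpace ℝ F] {π : E →L[ℝ] F} {s : F →L[ℝ] E} {y₀ : E} {δ : ℝ} {R : Set E}

/-- The product neighbourhood of radius `δ` of `y₀` in the splitting of `E` given by a section `s`
of `π`. -/
def tube (π : E →L[ℝ] F) (s : F →L[ℝ] E) (y₀ : E) (δ : ℝ) : Set E :=
  {y | y - s (π y) ∈ ball y₀ δ ∧ π y ∈ ball 0 δ}

lemma isOpen_tube : IsOpen (tube π s y₀ δ) :=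
  (isOpen_ball.preimage (by fun_prop : Continuous fun y => y - s (π y))).inter
    (isOpen_ball.preimage π.continuous)

lemma tube_subset_ball : tube π s y₀ δ ⊆ ball y₀ ((1 + ‖s‖) * δ) := by
  rintro y ⟨h₁, h₂⟩
  rw [mem_ball_zero_iff] at h₂
  rw [mem_ball_iff_norm] at h₁ ⊢
  calc ‖y - y₀‖ = ‖(y - s (π y) - y₀) + s (π y)‖ := by congr 1; abel
    _ ≤ ‖y - s (π y) - y₀‖ + ‖s‖ * ‖π y‖ :=
      (norm_add_le _ _).trans (add_le_add le_rfl (s.le_opNorm _))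
    _ < δ + ‖s‖ * δ := add_lt_add_of_lt_of_le h₁ (by gcongr)
    _ = (1 + ‖s‖) * δ := by ring

/-- The splitting of a tube in `R` into its slice and a ball. -/
def tubeHomeomorph (hs : Function.RightInverse s π)
    (hR : ∀ y ∈ R ∩ tube π s y₀ δ, ∀ z ∈ ball (0 : F) δ, y + s (z - π y) ∈ R) :
    ↥(R ∩ tube π s y₀ δ) ≃ₜ ↥(R ∩ (π ⁻¹' {0} ∩ ball y₀ δ)) × ball (0 : F) δ where
  toFun y := (⟨y - s (π y), by
    have hδ : 0 < δ := (norm_nonneg _).trans_lt (mem_ball_zero_iff.1 y.2.2.2)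
    have hy := hR y y.2 0 (mem_ball_self hδ)
    rw [zero_sub, map_neg, ← sub_eq_add_neg] at hy
    exact ⟨hy, by simp [hs (π y)], y.2.2.1⟩⟩, ⟨π y, y.2.2.2⟩)
  invFun u := ⟨u.1 + s u.2, by
    obtain ⟨⟨y, hyR, hy, hyδ⟩, z, hz⟩ := u
    rw [mem_preimage, mem_singleton_iff] at hy
    have hδ : 0 < δ := (norm_nonneg _).trans_lt (mem_ball_zero_iff.1 hz)
    refine ⟨?_, ?_⟩
    · simpa [hy] using hR y ⟨hyR, by simpa [tube, hy, hδ] using hyδ⟩ z hz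
    · simpa [tube, hy, hs z] using And.intro hyδ (mem_ball_zero_iff.1 hz)⟩
  left_inv y := by simp
  right_inv u := by
    obtain ⟨⟨y, hyR, hy, hyδ⟩, z, hz⟩ := u
    rw [mem_preimage, mem_singleton_iff] at hy
    simp [hy, hs z]
  continuous_toFun := by fun_prop
  continuous_invFun := by fun_prop

end Tube

section Charts

open Metric

variable {E H M : Type*} [NormedAddCommGroup E] [NormedSpace ℝ E] [TopologicalSpace H]
  {J : ModelWithCorners ℝ E H} [TopologicalSpace M]

lemma exists_ball_subset_extend_target (e : OpenPartialHomeomorph M H) {x : M} (hx : x ∈ e.source)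
    {W : Set M} (hW : W ∈ 𝓝 x) :
    ∃ ρ > 0, range J ∩ ball (e.extend J x) ρ ⊆ (e.extend J).target ∩ (e.extend J).symm ⁻¹' W := by
  have hW' : (e.extend J).symm ⁻¹' W ∈ 𝓝[(e.extend J).symm ⁻¹' univ ∩ range J] e.extend J x :=
    e.extend_preimage_mem_nhdsWithin hx (mem_nhdsWithin_of_mem_nhds hW)
  rw [preimage_univ, univ_inter] at hW'
  obtain ⟨ρ, hρ, hball⟩ :=
    Metric.mem_nhdsWithin_iff.1 (inter_mem (e.extend_target_mem_nhdsWithin hx) hW')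
  exact ⟨ρ, hρ, inter_comm _ _ ▸ hball⟩

/-- The restriction of an extended chart to the preimage of `O`. -/
def extendHomeomorph (J : ModelWithCorners ℝ E H) (e : OpenPartialHomeomorph M H) {O : Set E}
    (hO : range J ∩ O ⊆ (e.extend J).target) :
    ↥(e.source ∩ e.extend J ⁻¹' O) ≃ₜ ↥(range J ∩ O) where
  toFun x := ⟨e.extend J x, mem_range_self (e x), x.2.2⟩
  invFun y := ⟨(e.extend J).symm y,
    e.extend_source.subset ((e.extend J).map_target (hO y.2)),
    mem_preimage.2 (((e.extend J).right_inv (hO y.2)).symm ▸ y.2.2)⟩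
  left_inv x := Subtype.ext (e.extend_left_inv x.2.1)
  right_inv y := Subtype.ext ((e.extend J).right_inv (hO y.2))
  continuous_toFun := (e.continuousOn_extend.comp_continuous continuous_subtype_val fun x =>
    e.extend_source.superset x.2.1).subtype_mk _
  continuous_invFun := (e.continuousOn_extend_symm.comp_continuous continuous_subtype_val fun y =>
    hO y.2).subtype_mk _

lemma extend_symm_mem_subset (e : OpenPartialHomeomorph M H) {O : Set E} {W : Set M}
    (hO : range J ∩ O ⊆ (e.extend J).symm ⁻¹' W) : e.source ∩ e.extend J ⁻¹' O ⊆ W := by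
  rintro x ⟨hx, hxO⟩
  have hxW : (e.extend J).symm (e.extend J x) ∈ W := hO ⟨mem_range_self (e x), hxO⟩
  rwa [e.extend_left_inv hx] at hxW

lemma exists_contractible_open_subset [ChartedSpace H M] (J : ModelWithCorners ℝ E H) {x : M}
    {W : Set M} (hW : W ∈ 𝓝 x) : ∃ V ⊆ W, IsOpen V ∧ x ∈ V ∧ ContractibleSpace V := by
  let e := chartAt H x
  have hx : x ∈ e.source := mem_chart_source H x
  obtain ⟨ρ, hρ, hball⟩ := exists_ball_subset_extend_target (J := J) e hx hW
  have hconvex : ContractibleSpace ↥(range J ∩ ball (e.extend J x) ρ) :=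
    (J.convex_range.inter (convex_ball _ _)).contractibleSpace
      ⟨_, mem_range_self _, mem_ball_self hρ⟩
  exact ⟨_, extend_symm_mem_subset e fun y hy => (hball hy).2, e.isOpen_extend_preimage isOpen_ball,
    ⟨hx, mem_ball_self hρ⟩, (extendHomeomorph J e fun y hy => (hball hy).1).contractibleSpace⟩

lemma exists_sliceChart_of_extend (e : OpenPartialHomeomorph M H) {x : M} (hx : x ∈ e.source)
    {S W : Set M} (hW : W ∈ 𝓝 x) {π : E →L[ℝ] ℂ} {s : ℂ →L[ℝ] E} (hs : Function.RightInverse s π)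
    (hπ : π (e.extend J x) = 0)
    (hsJ : ∀ᶠ u : E × ℂ in 𝓝 (e.extend J x, 0), u.1 ∈ range J →
      u.1 + s (u.2 - π u.1) ∈ range J)
    (hS : ∀ᶠ x' in 𝓝 x, x' ∈ S ↔ π (e.extend J x') = 0) :
    ∃ V ⊆ W, IsOpen V ∧ x ∈ V ∧ V ⊆ e.source ∧ ∃ (C : Set E) (δ : ℝ) (φ : SliceChart S V C δ),
      ContractibleSpace C ∧ ∀ x' : V, ((φ.toHomeomorph x').2 : ℂ) = π (e.extend J x') := by
  set y₀ := e.extend J x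
  obtain ⟨ρ, hρ, hball⟩ := exists_ball_subset_extend_target (J := J) e hx (inter_mem hW hS)
  obtain ⟨ε, hε, hJ⟩ := eventually_nhds_iff_ball.1 hsJ
  have hs₀ : 0 < 1 + ‖s‖ := by positivity
  obtain ⟨δ, hδ, hδρ, hδε, hδε'⟩ :
      ∃ δ > 0, (1 + ‖s‖) * δ ≤ ρ ∧ (1 + ‖s‖) * δ ≤ ε ∧ δ ≤ ε := by
    have hle : (1 + ‖s‖) * (min ρ ε / (1 + ‖s‖)) = min ρ ε := mul_div_cancel₀ _ hs₀.ne'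
    exact ⟨min ρ ε / (1 + ‖s‖), div_pos (lt_min hρ hε) hs₀, hle.trans_le (min_le_left _ _),
      hle.trans_le (min_le_right _ _), (div_le_self (lt_min hρ hε).le
        (le_add_of_nonneg_right (norm_nonneg s))).trans (min_le_right _ _)⟩
  have hy₀δ : y₀ ∈ tube π s y₀ δ := by simp [tube, hπ, hδ]
  have htube : range J ∩ tube π s y₀ δ ⊆ range J ∩ ball y₀ ρ :=
    inter_subset_inter_right _ (tube_subset_ball.trans (ball_subset_ball hδρ))
  have htarget : range J ∩ tube π s y₀ δ ⊆ (e.extend J).target := fun y hy =>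
    (hball (htube hy)).1
  have hV := extend_symm_mem_subset e fun y hy => (hball (htube hy)).2
  let Φ := (extendHomeomorph J e htarget).trans (tubeHomeomorph hs fun y hy z hz =>
    hJ (y, z) (ball_prod_same y₀ (0 : ℂ) ε ▸ ⟨ball_subset_ball hδε (tube_subset_ball hy.2),
      ball_subset_ball hδε' hz⟩) hy.1)
  refine ⟨_, hV.trans inter_subset_left, e.isOpen_extend_preimage isOpen_tube, ⟨hx, hy₀δ⟩,
    inter_subset_left, _, δ, ⟨Φ, fun x' => (hV x'.2).2, hδ⟩, ?_, fun x' => rfl⟩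
  have hconvex : Convex ℝ (π ⁻¹' {0}) := (convex_singleton 0).linear_preimage π.toLinearMap
  exact (J.convex_range.inter (hconvex.inter (convex_ball _ _))).contractibleSpace
    ⟨y₀, mem_range_self _, hπ, mem_ball_self hδ⟩

end Charts

section Charts

variable {E H M : Type*} [NormedAddCommGroup E] [NormedSpace ℝ E] [TopologicalSpace H]
  {J : ModelWithCorners ℝ E H} [TopologicalSpace M] {e : OpenPartialHomeomorph M H} {x : M}

lemma IsBoundaryModel.exists_functional_of_notMem_interior (hJ : IsBoundaryModel J) {y : E}
    (hyi : y ∉ interior (range J)) (hy : y ∈ range J) :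
    ∃ a : E →L[ℝ] ℝ, a ≠ 0 ∧ a y = 0 ∧ range J = {x | 0 ≤ a x} ∧
      interior (range J) = {x | 0 < a x} := by
  obtain ⟨a, ha⟩ := hJ
  have ha₀ : a ≠ 0 := by
    rintro rfl
    simp [ha] at hyi
  have hai : interior (range J) = {x | 0 < a x} := by
    rw [ha, show {x | 0 ≤ a x} = a ⁻¹' Ici 0 from rfl,
      ← (a.isOpenMap_of_ne_zero ha₀).preimage_interior_eq_interior_preimage a.continuous,
      interior_Ici]
    rfl
  rw [ha] at hy
  rw [hai] at hyi
  exact ⟨a, ha₀, le_antisymm (not_lt.1 hyi) hy, ha, hai⟩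

lemma eventually_exists_extend_eq (hx : x ∈ e.source) :
    ∀ᶠ y in 𝓝[range J] (e.extend J x), ∃ x' ∈ e.source, e.extend J x' = y :=
  mem_of_superset (e.extend_target_mem_nhdsWithin hx) fun _ hy =>
    ⟨_, e.extend_source.subset ((e.extend J).map_target hy), (e.extend J).right_inv hy⟩

variable [ChartedSpace H M]

lemma mdifferentiable_of_mem_maximalAtlas (he : e ∈ IsManifold.maximalAtlas J ∞ M) :
    e.MDifferentiable J J :=
  ⟨(contMDiffOn_of_mem_maximalAtlas he).mdifferentiableOn (by simp),
    (contMDiffOn_symm_of_mem_maximalAtlas he).mdifferentiableOn (by simp)⟩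

lemma mdifferentiableAt_extend (he : e ∈ IsManifold.maximalAtlas J ∞ M) (hx : x ∈ e.source) :
    MDifferentiableAt J 𝓘(ℝ, E) (e.extend J) x :=
  (e.contMDiffAt_extend he hx).mdifferentiableAt (by simp)

lemma mfderiv_extend_bijective (he : e ∈ IsManifold.maximalAtlas J ∞ M) (hx : x ∈ e.source) :
    Function.Bijective (mfderiv J 𝓘(ℝ, E) (e.extend J) x) := by
  have hd := mdifferentiable_of_mem_maximalAtlas he
  have hcomp : HasMFDerivAt J 𝓘(ℝ, E) (e.extend J) x (mfderiv J J e x) :=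
    J.hasMFDerivAt.comp x (hd.mdifferentiableAt hx).hasMFDerivAt
  exact hcomp.mfderiv ▸ hd.mfderiv_bijective hx

lemma notMem_boundary_iff_extend [IsManifold J ∞ M] (he : e ∈ IsManifold.maximalAtlas J ∞ M)
    (hx : x ∈ e.source) : x ∉ J.boundary M ↔ e.extend J x ∈ interior (range J) := by
  have hd := mdifferentiable_of_mem_maximalAtlas he
  have hmodel : J.IsInteriorPoint (e x) ↔ e.extend J x ∈ interior (range J) := by
    rw [ModelWithCorners.IsInteriorPoint, extChartAt_coe, Function.comp_apply, chartAt_self_eq]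
    rfl
  refine (J.isInteriorPoint_iff_not_isBoundaryPoint x).symm.trans (Iff.trans ?_ hmodel)
  refine ⟨(hd.mdifferentiableAt hx).isInteriorPoint_of_surjective_mfderiv
    (hd.mfderiv_surjective hx), fun h => ?_⟩
  have hsymm := (hd.symm.mdifferentiableAt (e.map_source hx)).isInteriorPoint_of_surjective_mfderiv
    (hd.symm.mfderiv_surjective (e.map_source hx)) h
  rwa [e.left_inv hx] at hsymm

end Charts

section Immersion

variable {E E' H H' M K : Type*} [NormedAddCommGroup E] [NormedSpace ℝ E] [NormedAddCommGroup E']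
  [NormedSpace ℝ E'] [TopologicalSpace H] [TopologicalSpace H'] {J : ModelWithCorners ℝ E H}
  {J' : ModelWithCorners ℝ E' H'} [TopologicalSpace M] [ChartedSpace H M] [TopologicalSpace K]
  [ChartedSpace H' K] {f : K → M} {k : K}

lemma extend_immersion (h : Manifold.IsImmersionAt J' J ∞ f k) {k' : K}
    (hk' : k' ∈ h.domChart.source) :
    h.codChart.extend J (f k') = h.equiv (h.domChart.extend J' k', 0) := by
  have heq := h.writtenInCharts ((h.domChart.extend J').map_source
    (h.domChart.extend_source.superset hk'))
  simpa only [Function.comp_apply, h.domChart.extend_left_inv hk'] using heq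

lemma mfderiv_extend_immersion (h : Manifold.IsImmersionAt J' J ∞ f k) (v : TangentSpace J' k) :
    mfderiv J 𝓘(ℝ, E) (h.codChart.extend J) (f k) (mfderiv J' J f k v) =
      h.equiv (mfderiv J' 𝓘(ℝ, E') (h.domChart.extend J') k v, 0) := by
  have hcod := (mdifferentiableAt_extend h.codChart_mem_maximalAtlas
    h.mem_codChart_source).hasMFDerivAt.comp k
      (h.contMDiffAt.mdifferentiableAt (by simp)).hasMFDerivAt
  let L : E' →L[ℝ] E := h.equiv.toContinuousLinearMap.comp (ContinuousLinearMap.inl ℝ _ _)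
  have hdom := (L.hasMFDerivAt (x := h.domChart.extend J' k)).comp k
    (mdifferentiableAt_extend h.domChart_mem_maximalAtlas h.mem_domChart_source).hasMFDerivAt
  have heq : h.codChart.extend J ∘ f =ᶠ[𝓝 k] L ∘ h.domChart.extend J' := by
    filter_upwards [h.domChart.open_source.mem_nhds h.mem_domChart_source] with k' hk'
    exact extend_immersion h hk'
  exact congrArg (fun T => T v) (hasMFDerivAt_unique hcod (hdom.congr_of_eventuallyEq heq))

variable [IsManifold J ∞ M] [IsManifold J' ∞ K]

lemma extend_mem_interior_range_iff (hf : ∀ k, f k ∈ J.boundary M ↔ k ∈ J'.boundary K)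
    (h : Manifold.IsImmersionAt J' J ∞ f k) {k' : K} (hk' : k' ∈ h.domChart.source) :
    h.codChart.extend J (f k') ∈ interior (range J) ↔
      h.domChart.extend J' k' ∈ interior (range J') := by
  rw [← notMem_boundary_iff_extend h.domChart_mem_maximalAtlas hk', ← hf,
    notMem_boundary_iff_extend h.codChart_mem_maximalAtlas (h.source_subset_preimage_source hk')]

/-- A vector that points into `K` at a boundary point leads to interior points of `K`, which are
interior points of `M`; so it points into `M`. -/
lemma exists_inward_functionals (hJ : IsBoundaryModel J) (hJ' : IsBoundaryModel J')
    (hf : ∀ k, f k ∈ J.boundary M ↔ k ∈ J'.boundary K) (h : Manifold.IsImmersionAt J' J ∞ f k)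
    (hk : k ∈ J'.boundary K) :
    ∃ (a : E →L[ℝ] ℝ) (a' : E' →L[ℝ] ℝ), range J = {y | 0 ≤ a y} ∧ range J' = {u | 0 ≤ a' u} ∧
      a' ≠ 0 ∧ ∀ v, 0 < a' v → 0 < a (h.equiv (v, 0)) := by
  have hsource := h.mem_domChart_source
  have hu : h.domChart.extend J' k ∉ interior (range J') := by
    rwa [← notMem_boundary_iff_extend h.domChart_mem_maximalAtlas hsource, not_not]
  have hy := mt (extend_mem_interior_range_iff hf h hsource).1 hu
  obtain ⟨a, -, hay, ha, hai⟩ := hJ.exists_functional_of_notMem_interior hy (mem_range_self _)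
  obtain ⟨a', ha₀, hau, ha', hai'⟩ :=
    hJ'.exists_functional_of_notMem_interior hu (mem_range_self _)
  refine ⟨a, a', ha, ha', ha₀, fun v hv => ?_⟩
  have hinward (t : ℝ) (ht : 0 < t) :
      h.domChart.extend J' k + t • v ∈ interior (range J') := by
    rw [hai', mem_ofPred_eq, map_add, map_smul, hau, zero_add]
    exact mul_pos ht hv
  have htendsto : Tendsto (fun t : ℝ => h.domChart.extend J' k + t • v) (𝓝[>] 0)
      (𝓝[range J'] (h.domChart.extend J' k)) := by
    refine tendsto_nhdsWithin_iff.2 ⟨?_, ?_⟩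
    · exact (Continuous.tendsto' (by fun_prop) 0 _ (by simp)).mono_left nhdsWithin_le_nhds
    · filter_upwards [self_mem_nhdsWithin] with t ht using interior_subset (hinward t ht)
  obtain ⟨t, ⟨k', hk', hkt⟩, ht⟩ :=
    ((htendsto.eventually (eventually_exists_extend_eq hsource)).and self_mem_nhdsWithin).exists
  have hpos := (extend_mem_interior_range_iff hf h hk').2 (hkt ▸ hinward t ht)
  have hsplit : (h.domChart.extend J' k + t • v, (0 : h.complement)) =
      (h.domChart.extend J' k, 0) + t • (v, 0) := by simp
  rw [hai, extend_immersion h hk', hkt, hsplit, map_add, map_smul, ← extend_immersion h hsource,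
    mem_ofPred_eq, map_add, map_smul, hay, zero_add] at hpos
  exact pos_of_mul_pos_right hpos ht.le

lemma eventually_mem_range_of_snd_eq_zero (hJ : IsBoundaryModel J) (hJ' : IsBoundaryModel J')
    (hf : ∀ k, f k ∈ J.boundary M ↔ k ∈ J'.boundary K) (h : Manifold.IsImmersionAt J' J ∞ f k) :
    ∀ᶠ y in 𝓝 (h.codChart.extend J (f k)), y ∈ range J → (h.equiv.symm y).2 = 0 →
      (h.equiv.symm y).1 ∈ range J' := by
  by_cases hk : k ∈ J'.boundary K
  · obtain ⟨a, a', ha, ha', -, hpos⟩ := exists_inward_functionals hJ hJ' hf h hk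
    refine .of_forall fun y hy hy₀ => ?_
    have hsplit : h.equiv ((h.equiv.symm y).1, 0) = y := by
      rw [← hy₀, Prod.mk.eta, h.equiv.apply_symm_apply]
    rw [ha] at hy
    rw [ha', mem_ofPred_eq]
    by_contra! hneg
    have hpos' := hpos (-(h.equiv.symm y).1) (by simpa using hneg)
    rw [← neg_zero (G := h.complement), ← Prod.neg_mk, map_neg, hsplit, map_neg] at hpos'
    exact (neg_pos.1 hpos').not_ge hy
  · rw [notMem_boundary_iff_extend h.domChart_mem_maximalAtlas h.mem_domChart_source,
      mem_interior_iff_mem_nhds] at hk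
    refine (ContinuousAt.eventually_mem (by fun_prop) ?_).mono fun y hy _ _ => hy
    rwa [extend_immersion h h.mem_domChart_source, h.equiv.symm_apply_apply]

lemma eventually_mem_range_iff (hJ : IsBoundaryModel J) (hJ' : IsBoundaryModel J')
    (hf : ∀ k, f k ∈ J.boundary M ↔ k ∈ J'.boundary K) (hemb : Topology.IsInducing f)
    (h : Manifold.IsImmersionAt J' J ∞ f k) :
    ∀ᶠ x in 𝓝 (f k), x ∈ range f ↔ (h.equiv.symm (h.codChart.extend J x)).2 = 0 := by
  have hk := h.mem_domChart_source
  have hextend : ContinuousAt (h.codChart.extend J) (f k) :=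
    h.codChart.continuousAt_extend h.mem_codChart_source
  have hfst : ContinuousAt (fun x => (h.equiv.symm (h.codChart.extend J x)).1) (f k) :=
    (continuous_fst.comp h.equiv.symm.continuous).continuousAt.comp hextend
  have hfstk : (h.equiv.symm (h.codChart.extend J (f k))).1 = h.domChart.extend J' k := by
    rw [extend_immersion h hk, h.equiv.symm_apply_apply]
  have hlift := hfst.eventually
    (hfstk ▸ eventually_nhdsWithin_iff.1 (eventually_exists_extend_eq hk))
  have hrange := hextend.eventually (eventually_mem_range_of_snd_eq_zero hJ hJ' hf h)
  obtain ⟨O, hO, hOs⟩ := hemb.isOpen_iff.1 h.domChart.open_source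
  filter_upwards [hlift, hrange, hO.mem_nhds (hOs.superset hk),
    h.codChart.open_source.mem_nhds h.mem_codChart_source] with x hx hxr hxO hxs
  constructor
  · rintro ⟨k', rfl⟩
    rw [extend_immersion h (hOs.subset hxO), h.equiv.symm_apply_apply]
  · intro hx₀
    obtain ⟨k', hk', hkx⟩ := hx (hxr (mem_range_self _) hx₀)
    have heq : h.codChart.extend J (f k') = h.codChart.extend J x := by
      rw [extend_immersion h hk', hkx, ← hx₀, Prod.mk.eta, h.equiv.apply_symm_apply]
    refine ⟨k', (h.codChart.extend J).injOn ?_ ?_ heq⟩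
    · exact h.codChart.extend_source.superset (h.source_subset_preimage_source hk')
    · exact h.codChart.extend_source.superset hxs

lemma exists_section_of_slice {F : Type*} [NormedAddCommGroup F] [NormedSpace ℝ F]
    [FiniteDimensional ℝ F] (hJ : IsBoundaryModel J) (hJ' : IsBoundaryModel J')
    (hf : ∀ k, f k ∈ J.boundary M ↔ k ∈ J'.boundary K) (h : Manifold.IsImmersionAt J' J ∞ f k)
    {π : E →L[ℝ] F} (hπ : Function.Surjective π) (hπ₀ : ∀ u, π (h.equiv (u, 0)) = 0) :
    ∃ s : F →L[ℝ] E, Function.RightInverse s π ∧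
      ∀ᶠ u : E × F in 𝓝 (h.codChart.extend J (f k), 0), u.1 ∈ range J →
        u.1 + s (u.2 - π u.1) ∈ range J := by
  obtain ⟨s, hπs⟩ := π.exists_rightInverse_of_surjective (LinearMap.range_eq_top.2 hπ)
  have hs : Function.RightInverse s π := DFunLike.congr_fun hπs
  by_cases hk : k ∈ J'.boundary K
  · obtain ⟨a, a', ha, -, ha₀, hpos⟩ := exists_inward_functionals hJ hJ' hf h hk
    obtain ⟨v, hv⟩ : ∃ v, 0 < a' v := by
      by_contra! hnonpos
      exact ha₀ (ContinuousLinearMap.ext fun v => le_antisymm (hnonpos v) (by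
        simpa using hnonpos (-v)))
    -- Correcting the section along `v` makes it tangent to the boundary.
    let w := h.equiv (v, 0)
    refine ⟨s - ((a w)⁻¹ • a.comp s).smulRight w, fun z => ?_, .of_forall fun u hu => ?_⟩
    · simp [w, hs z, hπ₀]
    · have haw : a w ≠ 0 := (hpos v hv).ne'
      rw [ha, mem_ofPred_eq] at hu ⊢
      have hsection : a ((s - ((a w)⁻¹ • a.comp s).smulRight w) (u.2 - π u.1)) = 0 := by
        simp [mul_comm (a w)⁻¹, haw]
      rwa [map_add, hsection, add_zero]
  · rw [← hf, notMem_boundary_iff_extend h.codChart_mem_maximalAtlas h.mem_codChart_source,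
      mem_interior_iff_mem_nhds] at hk
    refine ⟨s, hs, (ContinuousAt.eventually_mem (by fun_prop) ?_).mono fun u hu _ => hu⟩
    have hπk : π (h.codChart.extend J (f k)) = 0 := by
      rw [extend_immersion h h.mem_domChart_source, hπ₀]
    rwa [hπk, sub_zero, map_zero, add_zero]

end Immersion

section Orientation

open Module

lemma exists_isPositiveBasis_iff {V : Type*} [AddCommGroup V] [Module ℝ V] {n : ℕ}
    (b₀ : Basis (Fin n) ℝ V) (o : Orientation ℝ V (Fin n)) :
    ∃ c : ℝ, c ≠ 0 ∧ ∀ v : Fin n → V, IsPositiveBasis o v ↔ 0 < c * b₀.det v := by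
  have exists_basis {v : Fin n → V} (hv : b₀.det v ≠ 0) : ∃ b : Basis (Fin n) ℝ V, ⇑b = v := by
    obtain ⟨hli, hsp⟩ := (Basis.is_basis_iff_det b₀).2 hv.isUnit
    exact ⟨Basis.mk hli hsp.ge, Basis.coe_mk _ _⟩
  rcases b₀.orientation_eq_or_eq_neg o with rfl | rfl
  · refine ⟨1, one_ne_zero, fun v => ⟨?_, fun hv => ?_⟩⟩
    · rintro ⟨b, rfl, hb⟩
      rw [one_mul, ← b₀.orientation_eq_iff_det_pos, hb]
    · rw [one_mul] at hv
      obtain ⟨b, rfl⟩ := exists_basis hv.ne'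
      exact ⟨b, rfl, ((b₀.orientation_eq_iff_det_pos b).2 hv).symm⟩
  · refine ⟨-1, neg_ne_zero.2 one_ne_zero, fun v => ⟨?_, fun hv => ?_⟩⟩
    · rintro ⟨b, rfl, hb⟩
      have hle : b₀.det b ≤ 0 := by
        rw [← not_lt, ← b₀.orientation_eq_iff_det_pos, hb]
        exact Module.Ray.ne_neg_self _
      have hlt := hle.lt_of_ne (b₀.isUnit_det b).ne_zero
      linarith
    · have hneg : b₀.det v < 0 := by linarith
      obtain ⟨b, rfl⟩ := exists_basis hneg.ne
      refine ⟨b, rfl, ?_⟩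
      rw [← Basis.orientation_ne_iff_eq_neg, Ne, eq_comm, b₀.orientation_eq_iff_det_pos]
      exact hneg.not_gt

lemma det_prod_sumElim {R V P ι κ : Type*} [CommRing R] [AddCommGroup V] [Module R V]
    [AddCommGroup P] [Module R P] [Fintype ι] [DecidableEq ι] [Fintype κ] [DecidableEq κ]
    (b₀ : Basis ι R V) (c₀ : Basis κ R P) (b : ι → V) (w : κ → V × P) :
    (b₀.prod c₀).det (Sum.elim (fun i => (b i, 0)) w) =
      b₀.det b * c₀.det fun j => (w j).2 := by
  have hblocks : (b₀.prod c₀).toMatrix (Sum.elim (fun i => (b i, 0)) w) =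
      Matrix.fromBlocks (b₀.toMatrix b) (b₀.toMatrix fun j => (w j).1) 0
        (c₀.toMatrix fun j => (w j).2) := by
    ext (i | i) (j | j) <;> simp [Basis.toMatrix_apply]
  rw [Basis.det_apply, hblocks, Matrix.det_fromBlocks_zero₂₁, Basis.det_apply, Basis.det_apply]

lemma exists_basis_det_append {𝕜 V W P : Type*} [Field 𝕜] [AddCommGroup V] [Module 𝕜 V]
    [AddCommGroup W] [Module 𝕜 W] [AddCommGroup P] [Module 𝕜 P] {m n : ℕ}
    {D : V →ₗ[𝕜] W} {Q : W →ₗ[𝕜] P} (hDQ : Function.Exact D Q) (hD : Function.Injective D)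
    (hQ : Function.Surjective Q) (b₀ : Basis (Fin m) 𝕜 V) (c₀ : Basis (Fin n) 𝕜 P) :
    ∃ B₀ : Basis (Fin (m + n)) 𝕜 W, ∀ (b : Fin m → V) (w : Fin n → W),
      B₀.det (Fin.append (D ∘ b) w) = b₀.det b * c₀.det (Q ∘ w) := by
  obtain ⟨l, hl⟩ := Q.exists_rightInverse_of_surjective (LinearMap.range_eq_top.2 hQ)
  obtain ⟨e, heD, heQ⟩ := hDQ.splitSurjectiveEquiv hD ⟨l, hl⟩
  refine ⟨((b₀.prod c₀).reindex finSumFinEquiv).map e.symm, fun b w => ?_⟩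
  have happend : e ∘ Fin.append (D ∘ b) w ∘ finSumFinEquiv =
      Sum.elim (fun i => (b i, 0)) (e ∘ w) := by
    ext1 (i | j)
    · simp [heD]
    · simp
  rw [Basis.det_map, Basis.det_reindex, LinearEquiv.symm_symm, Function.comp_assoc, happend,
    det_prod_sumElim, heQ]
  rfl

lemma exists_orientation_compatible_coordinate {V W : Type*} [AddCommGroup V] [Module ℝ V]
    [AddCommGroup W] [Module ℝ W] {m : ℕ} {D : V →ₗ[ℝ] W} {Q : W →ₗ[ℝ] ℂ}
    (hDQ : Function.Exact D Q) (hD : Function.Injective D) (hQ : Function.Surjective Q)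
    (b₀ : Basis (Fin m) ℝ V) (oV : Orientation ℝ V (Fin m)) (oW : Orientation ℝ W (Fin (m + 2))) :
    ∃ C : ℂ ≃L[ℝ] ℂ, ∀ (b : Fin m → V) (w₁ w₂ : W), C (Q w₁) = 1 → C (Q w₂) = Complex.I →
      (IsPositiveBasis oV b ↔ IsPositiveBasis oW (Fin.append (D ∘ b) ![w₁, w₂])) := by
  obtain ⟨B₀, hB₀⟩ := exists_basis_det_append hDQ hD hQ b₀ Complex.basisOneI
  obtain ⟨cV, hcV, hV⟩ := exists_isPositiveBasis_iff b₀ oV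
  obtain ⟨cW, hcW, hW⟩ := exists_isPositiveBasis_iff B₀ oW
  have hdet (w₁ w₂ : W) : Complex.basisOneI.det (Q ∘ ![w₁, w₂]) =
      (Q w₁).re * (Q w₂).im - (Q w₂).re * (Q w₁).im := by
    simp [Basis.det_apply, Matrix.det_fin_two, Basis.toMatrix_apply, mul_comm]
  have pos_iff {c d : ℝ} (hcd : 0 < c * d) (x : ℝ) : 0 < c * x ↔ 0 < d * x := by
    rcases pos_and_pos_or_neg_and_neg_of_mul_pos hcd with ⟨hc, hd⟩ | ⟨hc, hd⟩ <;>
      simp [mul_pos_iff, hc, hd, hc.not_gt, hd.not_gt]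
  simp only [hV, hW, hB₀, hdet]
  rcases (mul_ne_zero hcV hcW).lt_or_gt with hneg | hpos
  · refine ⟨Complex.conjCLE, fun b w₁ w₂ h₁ h₂ => ?_⟩
    have h₁' : Q w₁ = 1 := by simpa using congrArg (starRingEnd ℂ) h₁
    have h₂' : Q w₂ = -Complex.I := by simpa using congrArg (starRingEnd ℂ) h₂
    simpa [h₁', h₂'] using pos_iff (d := -cW) (by linarith) (b₀.det b)
  · refine ⟨.refl ℝ ℂ, fun b w₁ w₂ h₁ h₂ => ?_⟩
    have h₁' : Q w₁ = 1 := h₁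
    have h₂' : Q w₂ = Complex.I := h₂
    simpa [h₁', h₂'] using pos_iff hpos (b₀.det b)

lemma finrank_eq_of_prod_equiv {m n : ℕ} {F : Type*} [NormedAddCommGroup F] [NormedSpace ℝ F]
    (L : (EuclideanSpace ℝ (Fin m) × F) ≃L[ℝ] EuclideanSpace ℝ (Fin (m + n))) :
    FiniteDimensional ℝ F ∧ finrank ℝ F = n := by
  have : FiniteDimensional ℝ (EuclideanSpace ℝ (Fin m) × F) :=
    L.toLinearEquiv.symm.finiteDimensional
  have : FiniteDimensional ℝ F :=
    .of_injective (LinearMap.inr ℝ (EuclideanSpace ℝ (Fin m)) F) LinearMap.inr_injective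
  have hrank := L.toLinearEquiv.finrank_eq
  rw [Module.finrank_prod, finrank_euclideanSpace_fin, finrank_euclideanSpace_fin] at hrank
  exact ⟨this, Nat.add_left_cancel hrank⟩

end Orientation

section Immersion

variable {E E' H H' M K : Type*} [NormedAddCommGroup E] [NormedSpace ℝ E]
  [NormedAddCommGroup E'] [NormedSpace ℝ E'] [TopologicalSpace H] [TopologicalSpace H']
  {J : ModelWithCorners ℝ E H} {J' : ModelWithCorners ℝ E' H'}
  [TopologicalSpace M] [ChartedSpace H M] [TopologicalSpace K] [ChartedSpace H' K]
  {f : K → M} {k : K}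

lemma mfderiv_immersion_injective (h : Manifold.IsImmersionAt J' J ∞ f k) :
    Function.Injective (mfderiv J' J f k) := by
  intro v w hvw
  have heq := (mfderiv_extend_immersion h v).symm.trans
    ((congrArg _ hvw).trans (mfderiv_extend_immersion h w))
  exact (mfderiv_extend_bijective h.domChart_mem_maximalAtlas h.mem_domChart_source).1
    (congrArg Prod.fst (h.equiv.injective heq))

lemma mfderiv_immersion_exact (h : Manifold.IsImmersionAt J' J ∞ f k) :
    Function.Exact (mfderiv J' J f k) fun w : TangentSpace J (f k) =>
      (h.equiv.symm (mfderiv J 𝓘(ℝ, E) (h.codChart.extend J) (f k) w)).2 := by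
  intro w
  constructor
  · intro hw
    obtain ⟨v, hv⟩ := (mfderiv_extend_bijective h.domChart_mem_maximalAtlas
      h.mem_domChart_source).2 (h.equiv.symm (mfderiv J 𝓘(ℝ, E) (h.codChart.extend J) (f k) w)).1
    refine ⟨v, (mfderiv_extend_bijective h.codChart_mem_maximalAtlas h.mem_codChart_source).1 ?_⟩
    refine (mfderiv_extend_immersion h v).trans ?_
    rw [hv, ← hw]
    exact h.equiv.apply_symm_apply _
  · rintro ⟨v, rfl⟩
    have heq := congrArg h.equiv.symm (mfderiv_extend_immersion h v)
    exact congrArg Prod.snd (heq.trans (h.equiv.symm_apply_apply _))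

end Immersion

section OrientedEquation

open Module

variable {m : ℕ} {H H' : Type*} [TopologicalSpace H] [TopologicalSpace H']
  {J : ModelWithCorners ℝ (EuclideanSpace ℝ (Fin (m + 2))) H}
  {J' : ModelWithCorners ℝ (EuclideanSpace ℝ (Fin m)) H'}
  {M : Type*} [TopologicalSpace M] [ChartedSpace H M]
  {K : Type*} [TopologicalSpace K] [ChartedSpace H' K] {f : K → M} {k : K}

lemma exists_normal_coordinate (h : Manifold.IsImmersionAt J' J ∞ f k) :
    ∃ π : EuclideanSpace ℝ (Fin (m + 2)) →L[ℝ] ℂ, Function.Surjective π ∧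
      ∀ y, π y = 0 ↔ (h.equiv.symm y).2 = 0 := by
  obtain ⟨hfd, hrank⟩ := finrank_eq_of_prod_equiv h.equiv
  let c : h.complement ≃L[ℝ] ℂ := .ofFinrankEq (hrank.trans Complex.finrank_real_complex.symm)
  exact ⟨c.toContinuousLinearMap ∘L .snd ℝ _ _ ∘L h.equiv.symm.toContinuousLinearMap,
    c.surjective.comp (Prod.snd_surjective.comp h.equiv.symm.surjective),
    fun y => c.map_eq_zero_iff⟩

variable [IsManifold J ∞ M] [IsManifold J' ∞ K]

lemma exists_sliceChart_of_normal_coordinate (hJ : IsBoundaryModel J) (hJ' : IsBoundaryModel J')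
    (hf : IsProperlyEmbedded J J' f) (h : Manifold.IsImmersionAt J' J ∞ f k)
    {π : EuclideanSpace ℝ (Fin (m + 2)) →L[ℝ] ℂ} (hπ : Function.Surjective π)
    (hπ₀ : ∀ y, π y = 0 ↔ (h.equiv.symm y).2 = 0) {W : Set M} (hW : W ∈ 𝓝 (f k)) :
    ∃ V ⊆ W, IsOpen V ∧ f k ∈ V ∧ V ⊆ h.codChart.source ∧
      ∃ (C : Set (EuclideanSpace ℝ (Fin (m + 2)))) (δ : ℝ) (φ : SliceChart (range f) V C δ),
        ContractibleSpace C ∧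
          ∀ x : V, ((φ.toHomeomorph x).2 : ℂ) = π (h.codChart.extend J x) := by
  have hind := hf.isSmoothEmbedding.isEmbedding.isInducing
  have hπ_equiv : ∀ u, π (h.equiv (u, 0)) = 0 := fun u => by rw [hπ₀, h.equiv.symm_apply_apply]
  obtain ⟨s, hs, hsJ⟩ := exists_section_of_slice hJ hJ' hf.boundary_iff h hπ hπ_equiv
  have hk : π (h.codChart.extend J (f k)) = 0 := by
    rw [extend_immersion h h.mem_domChart_source, hπ_equiv]
  have hrange : ∀ᶠ x in 𝓝 (f k), x ∈ range f ↔ π (h.codChart.extend J x) = 0 := by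
    simpa only [hπ₀] using eventually_mem_range_iff hJ hJ' hf.boundary_iff hind h
  exact exists_sliceChart_of_extend h.codChart h.mem_codChart_source hW hs hk hsJ hrange

lemma exists_linear_isOrientedEquation (oM : ManifoldOrientation J M)
    (oK : ManifoldOrientation J' K) (h : Manifold.IsImmersionAt J' J ∞ f k) :
    ∃ π : EuclideanSpace ℝ (Fin (m + 2)) →L[ℝ] ℂ, Function.Surjective π ∧
      (∀ y, π y = 0 ↔ (h.equiv.symm y).2 = 0) ∧
      ∀ V : Set M, IsOpen V → f k ∈ V → V ⊆ h.codChart.source →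
        (∀ x ∈ V, π (h.codChart.extend J x) = 0 ↔ x ∈ range f) →
        IsOrientedEquation oM oK f k V fun x => π (h.codChart.extend J x) := by
  obtain ⟨π₀, hπ₀, hker⟩ := exists_normal_coordinate h
  let A : TangentSpace J (f k) →L[ℝ] EuclideanSpace ℝ (Fin (m + 2)) :=
    mfderiv J 𝓘(ℝ, EuclideanSpace ℝ (Fin (m + 2))) (h.codChart.extend J) (f k)
  have hA : Function.Bijective A :=
    mfderiv_extend_bijective h.codChart_mem_maximalAtlas h.mem_codChart_source
  have hexact : Function.Exact (mfderiv J' J f k).toLinearMap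
      (π₀.toLinearMap ∘ₗ A.toLinearMap) := fun w =>
    (hker _).trans (mfderiv_immersion_exact h w)
  obtain ⟨C, hC⟩ := exists_orientation_compatible_coordinate hexact (mfderiv_immersion_injective h)
    (hπ₀.comp hA.2) (EuclideanSpace.basisFun (Fin m) ℝ).toBasis (oK.at_ k) (oM.at_ (f k))
  let π : EuclideanSpace ℝ (Fin (m + 2)) →L[ℝ] ℂ := C.toContinuousLinearMap ∘L π₀
  have hπ : Function.Surjective π := C.surjective.comp hπ₀
  refine ⟨π, hπ, fun y => C.map_eq_zero_iff.trans (hker y), fun V hVo hkV hVs hV => ?_⟩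
  have hderiv : mfderiv J 𝓘(ℝ, ℂ) (fun x => π (h.codChart.extend J x)) (f k) = π ∘L A :=
    (π.hasMFDerivAt.comp (f k) (mdifferentiableAt_extend h.codChart_mem_maximalAtlas
      h.mem_codChart_source).hasMFDerivAt).mfderiv
  exact
    { isOpen := hVo
      mem := hkV
      smooth := π.contMDiff.comp_contMDiffOn
        ((h.codChart.contMDiffOn_extend h.codChart_mem_maximalAtlas).mono hVs)
      zero_iff := hV
      surjective := hderiv ▸ hπ.comp hA.2
      oriented := by
        rw [hderiv]
        exact fun b v₁ v₂ => hC b v₁ v₂ }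

lemma exists_sliceChart_isOrientedEquation (hJ : IsBoundaryModel J) (hJ' : IsBoundaryModel J')
    (oM : ManifoldOrientation J M) (oK : ManifoldOrientation J' K)
    (hf : IsProperlyEmbedded J J' f) (k : K) {W : Set M} (hW : W ∈ 𝓝 (f k)) :
    ∃ V ⊆ W, f k ∈ V ∧ ∃ (C : Set (EuclideanSpace ℝ (Fin (m + 2)))) (δ : ℝ)
      (φ : SliceChart (range f) V C δ) (g : M → ℂ), ContractibleSpace C ∧
        IsOrientedEquation oM oK f k V g ∧ ∀ x : V, ((φ.toHomeomorph x).2 : ℂ) = g x := by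
  have h := hf.isSmoothEmbedding.isImmersion.isImmersionAt k
  obtain ⟨π, hπ, hπ₀, hπ_oriented⟩ := exists_linear_isOrientedEquation oM oK h
  obtain ⟨V, hVW, hVo, hkV, hVs, C, δ, φ, hC, hφ⟩ :=
    exists_sliceChart_of_normal_coordinate hJ hJ' hf h hπ hπ₀ hW
  refine ⟨V, hVW, hkV, C, δ, φ, _, hC, hπ_oriented V hVo hkV hVs fun x hx => ?_, hφ⟩
  rw [← hφ ⟨x, hx⟩, ← φ.mem_iff]

lemma SliceChart.hasLinkingNumber_noose {oM : ManifoldOrientation J M}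
    {oK : ManifoldOrientation J' K} {V : Set M} {C : Type*} [TopologicalSpace C] {δ : ℝ}
    (φ : SliceChart (range f) V C δ) {g : M → ℂ} (hg : IsOrientedEquation oM oK f k V g)
    (hφ : ∀ x : V, ((φ.toHomeomorph x).2 : ℂ) = g x) :
    HasLinkingNumber oM oK f (φ.noose (φ.toHomeomorph ⟨f k, hg.mem⟩).1) 1 := by
  have hδ := φ.radius_pos
  refine ⟨k, V, g, ?_, hg, 1, one_pos, fun z _ => Subtype.coe_prop _, ?_⟩
  · have hcenter : φ.toHomeomorph ⟨f k, hg.mem⟩ =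
        ((φ.toHomeomorph ⟨f k, hg.mem⟩).1, φ.scale .center) := by
      refine Prod.ext rfl (Subtype.ext ?_)
      rw [(φ.mem_iff _).1 (mem_range_self k)]
      simp [scale, NooseSpace.center]
    exact congrArg Subtype.val (φ.toHomeomorph.eq_symm_apply.2 hcenter)
  · refine ⟨⟨fun t => Real.log (δ / 3) + 2 * Real.pi * Complex.I * (t : ℝ), by fun_prop⟩,
      fun t => ?_, by simp⟩
    refine Eq.trans ?_ (hφ (φ.toHomeomorph.symm (_, φ.scale (.diskPoint 1 t))))
    rw [Homeomorph.apply_symm_apply]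
    have hexp : Complex.exp (Real.log (δ / 3)) = (δ / 3 : ℝ) := by
      rw [← Complex.ofReal_exp, Real.exp_log (by positivity)]
    simp [Complex.exp_add, hexp, scale, NooseSpace.diskPoint, mul_comm]

end OrientedEquation

section Complement

variable {X Γ : Type*} [TopologicalSpace X] [Group Γ] {V T : Set X}

lemma isPathConnected_preimage_val [PathConnectedSpace V] (hVT : V ⊆ T) :
    IsPathConnected (Subtype.val ⁻¹' V : Set T) := by
  have h := isPathConnected_range (continuous_inclusion hVT)
  rwa [range_inclusion] at h

lemma PathCocycle.exists_isPotentialOn_preimage_val [SimplyConnectedSpace V] (hVT : V ⊆ T)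
    (F : PathCocycle T Γ) : ∃ τ, F.IsPotentialOn (Subtype.val ⁻¹' V) τ := by
  let q : C(V, T) := ⟨inclusion hVT, continuous_inclusion hVT⟩
  obtain ⟨τ, hτ⟩ := PathCocycle.exists_isPotentialOn_univ (F.comap q)
  refine hτ.exists_of_comap ((inclusion_injective hVT).factorsThrough τ) fun α hα => ?_
  exact ⟨⟨fun t => ⟨α t, hα t⟩, by fun_prop⟩, rfl⟩

end Complement

section QuotientCocycle

variable {A : Type*} [TopologicalSpace A] {p : A} (N : Subgroup (FundamentalGroup A p)) [N.Normal]
  (r : ∀ a, Path p a)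

/-- The path cocycle with values in a quotient of the fundamental group that is obtained by closing
up a path with the chosen paths `r` from the base point. -/
def quotientCocycle : PathCocycle A (FundamentalGroup A p ⧸ N) where
  val {a b} α := FundamentalGroup.fromPath (.mk (((r a).trans α).trans (r b).symm))
  val_trans {a b c} α β := by
    rw [← QuotientGroup.mk_mul, FundamentalGroup.mul_def]
    congr 1
    simp only [Path.Homotopic.Quotient.mk_trans, Path.Homotopic.Quotient.mk_symm,
      Path.Homotopic.Quotient.trans_assoc]
    rw [← Path.Homotopic.Quotient.trans_assoc (Path.Homotopic.Quotient.mk (r b)).symm,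
      Path.Homotopic.Quotient.symm_trans, Path.Homotopic.Quotient.refl_trans]
  val_homotopic h := by
    simp only [Path.Homotopic.Quotient.mk_trans, Path.Homotopic.Quotient.eq.2 h]

lemma quotientCocycle_val_eq_one_iff {a : A} (α : Path a a) :
    (quotientCocycle N r).val α = 1 ↔
      FundamentalGroup.fromPath (.mk (((r a).trans α).trans (r a).symm)) ∈ N :=
  QuotientGroup.eq_one_iff _

lemma fromPath_mem_of_quotientCocycle_val_eq_one {γ : Path p p}
    (h : (quotientCocycle N r).val γ = 1) : FundamentalGroup.fromPath (.mk γ) ∈ N := by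
  rw [quotientCocycle_val_eq_one_iff] at h
  have hconj : FundamentalGroup.fromPath (.mk (((r p).trans γ).trans (r p).symm)) =
      (FundamentalGroup.fromPath (.mk (r p)))⁻¹ * FundamentalGroup.fromPath (.mk γ) *
        FundamentalGroup.fromPath (.mk (r p)) := by
    simp only [Path.Homotopic.Quotient.mk_trans, Path.Homotopic.Quotient.mk_symm,
      Path.Homotopic.Quotient.trans_assoc]
    rfl
  have hmem := ‹N.Normal›.conj_mem _ (hconj ▸ h) (FundamentalGroup.fromPath (.mk (r p)))
  simpa only [mul_assoc, mul_inv_cancel_left, mul_inv_cancel, mul_one] using hmem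

lemma fromPath_mem_ker_map_iff {X : Type*} [TopologicalSpace X] {i : C(A, X)} {γ : Path p p} :
    FundamentalGroup.fromPath (.mk γ) ∈ (FundamentalGroup.map i p).ker ↔
      (γ.map i.continuous).Homotopic (Path.refl (i p)) :=
  Path.Homotopic.Quotient.eq

end QuotientCocycle

section Generation

variable {m : ℕ} {H H' : Type*} [TopologicalSpace H] [TopologicalSpace H']
  {J : ModelWithCorners ℝ (EuclideanSpace ℝ (Fin (m + 2))) H}
  {J' : ModelWithCorners ℝ (EuclideanSpace ℝ (Fin m)) H'}
  {M : Type*} [TopologicalSpace M] [ChartedSpace H M]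
  {K : Type*} [TopologicalSpace K] [ChartedSpace H' K] {f : K → M}

lemma IsProperlyEmbedded.compl_range_mem_nhds (hf : IsProperlyEmbedded J J' f) {x : M}
    (hx : x ∉ range f) : (range f)ᶜ ∈ 𝓝 x :=
  hf.isProperMap.isClosedMap.isClosed_range.isOpen_compl.mem_nhds hx

variable [IsManifold J ∞ M] [IsManifold J' ∞ K]

lemma exists_nhds_isPathConnected_preimage_val (hJ : IsBoundaryModel J)
    (hJ' : IsBoundaryModel J') (hf : IsProperlyEmbedded J J' f) (x : M) {W : Set M}
    (hW : W ∈ 𝓝 x) :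
    ∃ V ∈ 𝓝 x, V ⊆ W ∧ IsPathConnected (Subtype.val ⁻¹' V : Set ((range f)ᶜ : Set M)) := by
  by_cases hx : x ∈ range f
  · obtain ⟨k, rfl⟩ := hx
    have h := hf.isSmoothEmbedding.isImmersion.isImmersionAt k
    obtain ⟨π, hπ, hπ₀⟩ := exists_normal_coordinate h
    obtain ⟨V, hVW, hVo, hkV, -, C, δ, φ, hC, -⟩ :=
      exists_sliceChart_of_normal_coordinate hJ hJ' hf h hπ hπ₀ hW
    exact ⟨V, hVo.mem_nhds hkV, hVW, φ.isPathConnected_preimage⟩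
  · obtain ⟨V, hVW, hVo, hxV, hV⟩ :=
      exists_contractible_open_subset J (inter_mem hW (hf.compl_range_mem_nhds hx))
    exact ⟨V, hVo.mem_nhds hxV, hVW.trans inter_subset_left,
      isPathConnected_preimage_val (hVW.trans inter_subset_right)⟩

variable {oM : ManifoldOrientation J M} {oK : ManifoldOrientation J' K} {Γ : Type*} [Group Γ]
  {F : PathCocycle ((range f)ᶜ : Set M) Γ}

lemma PathCocycle.exists_nhds_isPotentialOn (hJ : IsBoundaryModel J) (hJ' : IsBoundaryModel J')
    (hf : IsProperlyEmbedded J J' f)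
    (hF : ∀ (c : M) (ν : Noose (range f) c), HasLinkingNumber oM oK f ν 1 → F.val ν.circle = 1)
    (x : M) : ∃ V ∈ 𝓝 x, ∃ τ, F.IsPotentialOn (Subtype.val ⁻¹' V) τ := by
  by_cases hx : x ∈ range f
  · obtain ⟨k, rfl⟩ := hx
    obtain ⟨V, -, hkV, C, δ, φ, g, hC, hg, hφ⟩ :=
      exists_sliceChart_isOrientedEquation hJ hJ' oM oK hf k univ_mem
    exact ⟨V, hg.isOpen.mem_nhds hkV,
      φ.exists_isPotentialOn (hF _ _ (φ.hasLinkingNumber_noose hg hφ))⟩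
  · obtain ⟨V, hVf, hVo, hxV, hV⟩ :=
      exists_contractible_open_subset J (hf.compl_range_mem_nhds hx)
    exact ⟨V, hVo.mem_nhds hxV, F.exists_isPotentialOn_preimage_val hVf⟩

theorem mem_closure_augmentation_image_of_homotopic_refl [PreconnectedSpace M]
    (hJ : IsBoundaryModel J) (hJ' : IsBoundaryModel J') (hf : IsProperlyEmbedded J J' f)
    {p : M} (hp : p ∉ range f) {γ : Path (⟨p, hp⟩ : ((range f)ᶜ : Set M)) ⟨p, hp⟩}
    (hγ : (γ.map continuous_subtype_val).Homotopic (Path.refl p)) :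
    FundamentalGroup.fromPath (.mk γ) ∈
      Subgroup.closure (augmentation (range f) p hp '' knotQuandle oM oK f p) := by
  have hconn (x : M) (W) (hW : W ∈ 𝓝 x) :=
    exists_nhds_isPathConnected_preimage_val hJ hJ' hf x hW
  have : Nonempty M := ⟨p⟩
  have : PathConnectedSpace ((range f)ᶜ : Set M) :=
    pathConnectedSpace_of_isPathConnected_preimage hconn
  have hnormal := normal_closure_augmentation_image (oM := oM) (oK := oK) hp
  let r (a : ((range f)ᶜ : Set M)) := PathConnectedSpace.somePath ⟨p, hp⟩ a
  have hmeridian (c : M) (ν : Noose (range f) c) (hν : HasLinkingNumber oM oK f ν 1) :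
      (quotientCocycle _ r).val ν.circle = 1 :=
    (quotientCocycle_val_eq_one_iff _ r _).2 (fromPath_circle_conj_mem_closure hp hν (r _))
  exact fromPath_mem_of_quotientCocycle_val_eq_one _ r
    (PathCocycle.val_eq_one_of_homotopic_refl continuous_subtype_val hconn
      (PathCocycle.exists_nhds_isPotentialOn hJ hJ' hf hmeridian) γ hγ)

end Generation

end KnotQuandle

end

open KnotQuandle in
theorem proposition10_general {m : ℕ}
    {H : Type*} [TopologicalSpace H]
    (J : ModelWithCorners ℝ (EuclideanSpace ℝ (Fin (m + 2))) H) (hJ : IsBoundaryModel J)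
    {H' : Type*} [TopologicalSpace H']
    (J' : ModelWithCorners ℝ (EuclideanSpace ℝ (Fin m)) H') (hJ' : IsBoundaryModel J')
    {M : Type*} [TopologicalSpace M] [PreconnectedSpace M] [ChartedSpace H M] [IsManifold J ∞ M]
    {K : Type*} [TopologicalSpace K] [ChartedSpace H' K] [IsManifold J' ∞ K]
    (oM : ManifoldOrientation J M) (oK : ManifoldOrientation J' K)
    (f : K → M) (hf : IsProperlyEmbedded J J' f) (p : M) (hp : p ∉ Set.range f) :
    Subgroup.closure (augmentation (Set.range f) p hp '' knotQuandle oM oK f p) =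
      (FundamentalGroup.map (⟨Subtype.val, continuous_subtype_val⟩ : C(((Set.range f)ᶜ : Set M), M))
        ⟨p, hp⟩).ker := by
  apply le_antisymm
  · rw [Subgroup.closure_le]
    rintro - ⟨-, ⟨ν, rfl, -⟩, rfl⟩
    exact fromPath_mem_ker_map_iff.2 (ν.map_canonicalLoop_homotopic_refl hp)
  · intro g hg
    obtain ⟨γ, rfl⟩ := Path.Homotopic.Quotient.mk_surjective g
    exact mem_closure_augmentation_image_of_homotopic_refl hJ hJ' hf hp
      (fromPath_mem_ker_map_iff.1 hg)

theorem proposition10 {m : ℕ}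
    {H : Type*} [TopologicalSpace H]
    (J : ModelWithCorners ℝ (EuclideanSpace ℝ (Fin (m + 2))) H)
    (hJ : KnotQuandle.IsBoundaryModel J)
    {H' : Type*} [TopologicalSpace H']
    (J' : ModelWithCorners ℝ (EuclideanSpace ℝ (Fin m)) H')
    (hJ' : KnotQuandle.IsBoundaryModel J')
    {M : Type*} [TopologicalSpace M] [T2Space M] [SecondCountableTopology M]
    [ChartedSpace H M] [IsManifold J ∞ M]
    {K : Type*} [TopologicalSpace K] [ChartedSpace H' K] [IsManifold J' ∞ K]
    (oM : KnotQuandle.ManifoldOrientation J M) (oK : KnotQuandle.ManifoldOrientation J' K)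
    (f : K → M) (hf : KnotQuandle.IsProperlyEmbedded J J' f)
    (p : M) (hp : p ∉ Set.range f)
    [SimplyConnectedSpace M] :
    Subgroup.closure
        (KnotQuandle.augmentation (Set.range f) p hp '' KnotQuandle.knotQuandle oM oK f p) =
      (⊤ : Subgroup (FundamentalGroup ((Set.range f)ᶜ : Set M) ⟨p, hp⟩)) := by
  rw [proposition10_general J hJ J' hJ' oM oK f hf p hp]
  exact eq_top_iff.2 fun _ _ => Subsingleton.elim (α := FundamentalGroup M p) _ _
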